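/- **The Fréchet distance decision problem.** A polygonal curve with $m\ge 1$ segments is a continuous map $P:[0,m]\to\mathbb R^n$ with $P(i+\lambda)=(1-\lambda)P(i)+\lambda P(i+1)$ for all integers $0\le i<m$ and all $0\le\lambda\le1$; as the input of an algorithm it is given by its vertices $P(0),\dots,P(m)$. Let $f:[0,m_f]\to\mathbb R^n$ and $g:[0,m_g]\to\mathbb R^n$ be polygonal curves, let $\chi=\lVert\cdot\rVert$ be a norm on $\mathbb R^n$, and let $$\mathcal F(f,g)=\inf_{\alpha_f,\alpha_g}\ \max_{0\le\theta\le1}\bigl\lVert f(\alpha_f(\theta))-g(\alpha_g(\theta))\bigr\rVert ,$$ where $\alpha_f:[0,1]\to[0,m_f]$ and $\alpha_g:[0,1]\to[0,m_g]$ range over the continuous strictly increasing bijections (reparametrizations). For $\delta\ge0$ the free space is $$\mathrm{Free}_\delta(f,g)=\{(\rho_f,\rho_g)\in[0,m_f]\times[0,m_g] : \lVert f(\rho_f)-g(\rho_g)\rVert\le\delta\},$$ and the parameters of the cell $(i,j)$, $0\le i<m_f$, $0\le j<m_g$, are, for each of the four edges of the square $[i,i+1]\times[j,j+1]$, the starting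 point and the ending point of the intersection of this edge with $\mathrm{Free}_\delta(f,g)$, or the information that the intersection is empty. The model of computation is a real random access machine with a read-only input and procedures: each elementary operation on counters, addresses and real numbers, each comparison and each procedure call costs one step; a call has its own (initially zero) local memory and costs in addition the steps that the procedure takes. Besides $+,-,\times,\div,\sqrt{\cdot}$, any further unit-cost binary operations on the reals may be supplied. There are a single algorithm $D$ and an absolute constant $C$ such that the following holds for every $n$, every norm $\chi$ on $\mathbb R^n$, every choice of the further operations, and every procedure which determines the parameters of a cell for the norm $\chi$ in at most $H=H(\chi)$ steps (for all polygonal curves in $\mathbb R^n$, all $\delta\ge0$ and all cells). For all polygonal curves $f:[0,m_f]\to\mathbb R^n$, $g:[0,m_g]\to\mathbb R^n$ and every $\delta\ge0$, the algorithm $D$, using this procedure, halts after at most $C\cdot m_f\cdot m_g\cdot H(\chi)$ steps and decides 1. whether $\mathcal F(f,g)\le\delta$, and 2. whether there exist reparametrizations $\alpha_f,\alpha_g$ (continuous strictly increasing bijections) with $\max_{0\le\theta\le1}\lVert f(\alpha_f(\theta))-g(\alpha_g(\theta))\rVert\le\delta$. -/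

import Mathlib

open Set

/-! ### Polygonal curves, reparametrizations, Fréchet distance, free space

A norm `χ` on `ℝⁿ` is a seminorm on `Fin n → ℝ` that vanishes only at `0`. A curve on `[0, m]` is
a function on `ℝ` of which only the values on `[0, m]` are used. -/

/-- `χ` is a norm on `ℝⁿ`: a seminorm which is positive definite. -/
def IsNorm {n : ℕ} (χ : Seminorm ℝ (Fin n → ℝ)) : Prop :=
  ∀ x, χ x = 0 → x = 0

/-- `P : [0, m] → ℝⁿ` is a polygonal curve with `m ≥ 1` segments: it is continuous, and on each
`[i, i + 1]` it interpolates linearly between `P i` and `P (i + 1)`. -/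
structure IsPolygonalCurve {n : ℕ} (m : ℕ) (P : ℝ → Fin n → ℝ) : Prop where
  pos : 0 < m
  continuousOn : ContinuousOn P (Icc (0 : ℝ) m)
  interp : ∀ i : ℕ, i < m → ∀ l ∈ Icc (0 : ℝ) 1,
    P ((i : ℝ) + l) = (1 - l) • P (i : ℝ) + l • P ((i : ℝ) + 1)

/-- `α : [0, 1] → [0, m]` is a continuous, strictly increasing bijection. -/
structure IsReparam (m : ℕ) (α : ℝ → ℝ) : Prop where
  continuousOn : ContinuousOn α (Icc (0 : ℝ) 1)
  strictMonoOn : StrictMonoOn α (Icc (0 : ℝ) 1)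
  bijOn : BijOn α (Icc (0 : ℝ) 1) (Icc (0 : ℝ) m)

/-- `r = max_{0 ≤ θ ≤ 1} ‖f (αf θ) - g (αg θ)‖`, the maximum being attained. -/
def IsMaxDeviation {n : ℕ} (χ : Seminorm ℝ (Fin n → ℝ)) (f g : ℝ → Fin n → ℝ)
    (αf αg : ℝ → ℝ) (r : ℝ) : Prop :=
  IsGreatest ((fun θ : ℝ => χ (f (αf θ) - g (αg θ))) '' Icc (0 : ℝ) 1) r

/-- The Fréchet distance of `f : [0, mf] → ℝⁿ` and `g : [0, mg] → ℝⁿ`: the infimum, over all pairs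
of reparametrizations, of the maximal deviation. -/
noncomputable def frechetDist {n : ℕ} (χ : Seminorm ℝ (Fin n → ℝ)) (mf mg : ℕ)
    (f g : ℝ → Fin n → ℝ) : ℝ :=
  sInf {r : ℝ | ∃ αf αg : ℝ → ℝ,
    IsReparam mf αf ∧ IsReparam mg αg ∧ IsMaxDeviation χ f g αf αg r}

/-- The `δ`-free space of `f : [0, mf] → ℝⁿ` and `g : [0, mg] → ℝⁿ`. -/
def freeSpace {n : ℕ} (χ : Seminorm ℝ (Fin n → ℝ)) (mf mg : ℕ)
    (f g : ℝ → Fin n → ℝ) (δ : ℝ) : Set (ℝ × ℝ) :=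
  {p | p.1 ∈ Icc (0 : ℝ) mf ∧ p.2 ∈ Icc (0 : ℝ) mg ∧ χ (f p.1 - g p.2) ≤ δ}

/-- The point with parameter `s ∈ [0, 1]` on edge `q` of the cell `[i, i + 1] × [j, j + 1]`; the
edges `0, 1, 2, 3` are the bottom, right, top and left one, each parametrized in the direction of
increasing coordinate. -/
def edgePoint (i j : ℕ) (q : Fin 4) (s : ℝ) : ℝ × ℝ :=
  match q with
  | 0 => ((i : ℝ) + s, (j : ℝ))
  | 1 => ((i : ℝ) + 1, (j : ℝ) + s)
  | 2 => ((i : ℝ) + s, (j : ℝ) + 1)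
  | 3 => ((i : ℝ), (j : ℝ) + s)

/-- The part of edge `q` of cell `(i, j)` which lies in the free space, as a set of parameters. -/
def freeEdge {n : ℕ} (χ : Seminorm ℝ (Fin n → ℝ)) (mf mg : ℕ)
    (f g : ℝ → Fin n → ℝ) (δ : ℝ) (i j : ℕ) (q : Fin 4) : Set ℝ :=
  {s | s ∈ Icc (0 : ℝ) 1 ∧ edgePoint i j q s ∈ freeSpace χ mf mg f g δ}

/-- `flag, a, b` describe the free part of edge `q` of cell `(i, j)`: either `flag = 0` and it is
empty, or `flag = 1` and `a`, `b` are its starting and its ending point. -/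
def IsEdgeParameters {n : ℕ} (χ : Seminorm ℝ (Fin n → ℝ)) (mf mg : ℕ)
    (f g : ℝ → Fin n → ℝ) (δ : ℝ) (i j : ℕ) (q : Fin 4) (flag : ℕ) (a b : ℝ) : Prop :=
  (flag = 0 ∧ freeEdge χ mf mg f g δ i j q = ∅) ∨
  (flag = 1 ∧ IsLeast (freeEdge χ mf mg f g δ i j q) a ∧
    IsGreatest (freeEdge χ mf mg f g δ i j q) b)

/-! ### A real random access machine with a step count

Programs are structured programs over natural registers (counters and addresses), real registers,
natural arrays and real arrays, with a read-only input and one procedure. Every elementary command,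
every test and every procedure call costs one step (a call costs in addition the steps that the
body of the procedure takes). Real numbers are handled exactly, at unit cost; they can be compared,
but cannot be turned into natural numbers. -/

namespace RealRAM

/-- The read-only input: two polygonal curves in dimension `dim`, with `segF` and `segG` segments
and given by the coordinates `coordF k c`, `coordG k c` of their vertices, and a real `delta`. -/
structure Input where
  dim : ℕ
  segF : ℕ
  segG : ℕ
  delta : ℝ
  coordF : ℕ → ℕ → ℝ
  coordG : ℕ → ℕ → ℝ

/-- The contents of the memory. -/
structure State where
  nat : ℕ → ℕ
  real : ℕ → ℝ
  natArr : ℕ → ℕ → ℕ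
  realArr : ℕ → ℕ → ℝ

/-- Unit-cost real operations: arithmetic, square root, and operations `ext k` whose meaning is
a parameter of the machine (so that norms beyond the reach of arithmetic can be treated too). -/
inductive RealOp where
  | plus | minus | times | divide | sqrt
  | ext (k : ℕ)

/-- The meaning of the real operations (`sqrt` uses its first argument only). -/
noncomputable def RealOp.eval (op : ℕ → ℝ → ℝ → ℝ) : RealOp → ℝ → ℝ → ℝ
  | .plus, x, y => x + y
  | .minus, x, y => x - y
  | .times, x, y => x * y
  | .divide, x, y => x / y
  | .sqrt, x, _ => Real.sqrt x
  | .ext k, x, y => op k x y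

/-- Elementary commands. Arguments `x y z` are names of registers, `a` is the name of an array. -/
inductive Basic where
  | nop
  | natConst (x c : ℕ)
  | natCopy (x y : ℕ)
  | natPlus (x y z : ℕ)
  | natMinus (x y z : ℕ)
  | natLoad (x a y : ℕ)
  | natStore (a y x : ℕ)
  | realConst (x : ℕ) (c : ℚ)
  | realCopy (x y : ℕ)
  | realOp (x : ℕ) (o : RealOp) (y z : ℕ)
  | realLoad (x a y : ℕ)
  | realStore (a y x : ℕ)
  | readDim (x : ℕ)
  | readSegF (x : ℕ)
  | readSegG (x : ℕ)
  | readDelta (x : ℕ)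
  | readF (x k c : ℕ)
  | readG (x k c : ℕ)

/-- The effect of an elementary command on the memory. -/
noncomputable def Basic.step (op : ℕ → ℝ → ℝ → ℝ) (inp : Input) (s : State) : Basic → State
  | .nop => s
  | .natConst x c => { s with nat := Function.update s.nat x c }
  | .natCopy x y => { s with nat := Function.update s.nat x (s.nat y) }
  | .natPlus x y z => { s with nat := Function.update s.nat x (s.nat y + s.nat z) }
  | .natMinus x y z => { s with nat := Function.update s.nat x (s.nat y - s.nat z) }
  | .natLoad x a y => { s with nat := Function.update s.nat x (s.natArr a (s.nat y)) }
  | .natStore a y x =>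
      { s with natArr :=
          Function.update s.natArr a (Function.update (s.natArr a) (s.nat y) (s.nat x)) }
  | .realConst x c => { s with real := Function.update s.real x (c : ℝ) }
  | .realCopy x y => { s with real := Function.update s.real x (s.real y) }
  | .realOp x o y z =>
      { s with real := Function.update s.real x (o.eval op (s.real y) (s.real z)) }
  | .realLoad x a y => { s with real := Function.update s.real x (s.realArr a (s.nat y)) }
  | .realStore a y x =>
      { s with realArr :=
          Function.update s.realArr a (Function.update (s.realArr a) (s.nat y) (s.real x)) }
  | .readDim x => { s with nat := Function.update s.nat x inp.dim }
  | .readSegF x => { s with nat := Function.update s.nat x inp.segF }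
  | .readSegG x => { s with nat := Function.update s.nat x inp.segG }
  | .readDelta x => { s with real := Function.update s.real x inp.delta }
  | .readF x k c => { s with real := Function.update s.real x (inp.coordF (s.nat k) (s.nat c)) }
  | .readG x k c => { s with real := Function.update s.real x (inp.coordG (s.nat k) (s.nat c)) }

/-- Tests: comparison of two natural registers or of two real registers. -/
inductive Test where
  | natLt (x y : ℕ)
  | realLe (x y : ℕ)

/-- The truth of a test. -/
def Test.Holds (s : State) : Test → Prop
  | .natLt x y => s.nat x < s.nat y
  | .realLe x y => s.real x ≤ s.real y

/-- Programs. `call x y` calls the procedure with the contents of the natural registers `x`, `y`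
as its two arguments. -/
inductive Program where
  | basic (b : Basic)
  | seq (p q : Program)
  | ite (c : Test) (p q : Program)
  | while (c : Test) (p : Program)
  | call (x y : ℕ)

/-- Memory filled with zeros. -/
def State.empty : State where
  nat := fun _ => 0
  real := fun _ => 0
  natArr := fun _ _ => 0
  realArr := fun _ _ => 0

/-- The local memory with which the procedure starts: its two arguments are in the natural
registers `0` and `1`, everything else is zero. -/
def State.local (i j : ℕ) : State :=
  { State.empty with nat := fun x => if x = 0 then i else if x = 1 then j else 0 }

/-- The return of the procedure: the contents of its natural registers `2, …, 5` and of its real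
registers `0, …, 7` are handed over to the same registers of the caller `s`; all other memory of
the caller is unchanged. -/
def State.return (s t : State) : State :=
  { s with
    nat := fun x => if 2 ≤ x ∧ x ≤ 5 then t.nat x else s.nat x
    real := fun x => if x ≤ 7 then t.real x else s.real x }

/-- `Exec op inp body p s s' t`: the program `p`, with the procedure body `body`, started on the
input `inp` with memory `s`, halts with memory `s'` after exactly `t` steps. -/
inductive Exec (op : ℕ → ℝ → ℝ → ℝ) (inp : Input) (body : Program) :
    Program → State → State → ℕ → Prop where
  | basic (b : Basic) (s : State) : Exec op inp body (.basic b) s (b.step op inp s) 1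
  | seq {p q : Program} {s₁ s₂ s₃ : State} {t₁ t₂ : ℕ}
      (h₁ : Exec op inp body p s₁ s₂ t₁) (h₂ : Exec op inp body q s₂ s₃ t₂) :
      Exec op inp body (.seq p q) s₁ s₃ (t₁ + t₂)
  | iteTrue {c : Test} {p q : Program} {s s' : State} {t : ℕ} (hc : c.Holds s)
      (h : Exec op inp body p s s' t) : Exec op inp body (.ite c p q) s s' (t + 1)
  | iteFalse {c : Test} {p q : Program} {s s' : State} {t : ℕ} (hc : ¬ c.Holds s)
      (h : Exec op inp body q s s' t) : Exec op inp body (.ite c p q) s s' (t + 1)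
  | whileTrue {c : Test} {p : Program} {s₁ s₂ s₃ : State} {t₁ t₂ : ℕ} (hc : c.Holds s₁)
      (h₁ : Exec op inp body p s₁ s₂ t₁) (h₂ : Exec op inp body (.while c p) s₂ s₃ t₂) :
      Exec op inp body (.while c p) s₁ s₃ (t₁ + t₂ + 1)
  | whileFalse {c : Test} {p : Program} {s : State} (hc : ¬ c.Holds s) :
      Exec op inp body (.while c p) s s 1
  | call {x y : ℕ} {s s' : State} {t : ℕ}
      (h : Exec op inp body body (State.local (s.nat x) (s.nat y)) s' t) :
      Exec op inp body (.call x y) s (s.return s') (t + 1)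

/-- Execution is deterministic, in its result and in its number of steps. -/
theorem Exec.deterministic {op : ℕ → ℝ → ℝ → ℝ} {inp : Input} {body p : Program}
    {s s₁ s₂ : State} {t₁ t₂ : ℕ} (h₁ : Exec op inp body p s s₁ t₁)
    (h₂ : Exec op inp body p s s₂ t₂) : s₁ = s₂ ∧ t₁ = t₂ := by
  induction h₁ generalizing s₂ t₂ with
  | basic b s => cases h₂; exact ⟨rfl, rfl⟩
  | seq _ _ ih₁ ih₂ =>
    cases h₂ with
    | seq k₁ k₂ =>
      obtain ⟨rfl, rfl⟩ := ih₁ k₁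
      obtain ⟨rfl, rfl⟩ := ih₂ k₂
      exact ⟨rfl, rfl⟩
  | iteTrue hc _ ih =>
    cases h₂ with
    | iteTrue _ k => obtain ⟨rfl, rfl⟩ := ih k; exact ⟨rfl, rfl⟩
    | iteFalse hc' _ => exact absurd hc hc'
  | iteFalse hc _ ih =>
    cases h₂ with
    | iteTrue hc' _ => exact absurd hc' hc
    | iteFalse _ k => obtain ⟨rfl, rfl⟩ := ih k; exact ⟨rfl, rfl⟩
  | whileTrue hc _ _ ih₁ ih₂ =>
    cases h₂ with
    | whileTrue _ k₁ k₂ =>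
      obtain ⟨rfl, rfl⟩ := ih₁ k₁
      obtain ⟨rfl, rfl⟩ := ih₂ k₂
      exact ⟨rfl, rfl⟩
    | whileFalse hc' => exact absurd hc hc'
  | whileFalse hc =>
    cases h₂ with
    | whileTrue hc' _ _ => exact absurd hc' hc
    | whileFalse _ => exact ⟨rfl, rfl⟩
  | call _ ih =>
    cases h₂ with
    | call k => obtain ⟨rfl, rfl⟩ := ih k; exact ⟨rfl, rfl⟩

/-- The input which represents the polygonal curves `f : [0, mf] → ℝⁿ`, `g : [0, mg] → ℝⁿ` and
`δ`: the curves are given by their vertices. -/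
noncomputable def Input.ofCurves {n : ℕ} (mf mg : ℕ) (f g : ℝ → Fin n → ℝ) (δ : ℝ) : Input where
  dim := n
  segF := mf
  segG := mg
  delta := δ
  coordF := fun k c => if h : k ≤ mf ∧ c < n then f (k : ℝ) ⟨c, h.2⟩ else 0
  coordG := fun k c => if h : k ≤ mg ∧ c < n then g (k : ℝ) ⟨c, h.2⟩ else 0

/-- The procedure body `body` determines the parameters of every cell for the norm `χ` on `ℝⁿ`
in at most `H` steps: called with arguments `i, j`, it returns, for each edge `q` of cell `(i, j)`,
the flag of the edge in the natural register `2 + q` and the starting and ending points of the free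
part of the edge in the real registers `q` and `4 + q`. -/
def ComputesCellParameters (op : ℕ → ℝ → ℝ → ℝ) (body : Program) {n : ℕ}
    (χ : Seminorm ℝ (Fin n → ℝ)) (H : ℕ) : Prop :=
  ∀ (mf mg : ℕ) (f g : ℝ → Fin n → ℝ) (δ : ℝ),
    IsPolygonalCurve mf f → IsPolygonalCurve mg g → 0 ≤ δ →
    ∀ i < mf, ∀ j < mg, ∃ (s : State) (t : ℕ),
      Exec op (Input.ofCurves mf mg f g δ) body body (State.local i j) s t ∧ t ≤ H ∧
      ∀ q : Fin 4, IsEdgeParameters χ mf mg f g δ i j q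
        (s.nat (2 + (q : ℕ))) (s.real (q : ℕ)) (s.real (4 + (q : ℕ)))

end RealRAM

/-! ### Monotone paths in the plane -/

/-! A pair of reparametrizations traces a path from the origin to `(mf, mg)`, increasing in both
coordinates, and its deviation is at most `δ` exactly when the path stays in the free space. Both
questions thus become reachability questions: by strictly monotone paths for the second
(`exists_reparam_iff_conn`) and by weakly monotone ones for the first (`frechetDist_le_iff_conn`).
In the first case the infimum need not be attained. Paths for `δ + 1 / (k + 1)` have a limit by
compactness (`Conn.iInter`), which may contain horizontal and vertical pieces; conversely, mixing a
little of the linear parametrization into a weak path makes it strict and, by uniform continuity,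
raises the deviation by as little as desired. The flag `b` lets one argument treat both kinds of
path.

Reachability is computed cell by cell. On a cell the difference of the curves is affine, so the free
space is convex there (`convex_freeSpace_inter_gridCell`), and a reachable point can be joined by a
segment to every free point above and to the right of it (`Conn.step`). Hence a single number per
edge suffices, the infimum `lo` of its reachable points. A monotone path to the right or top edge
must enter through the left or lower edge (`Conn.entry`), so the data of the former follow from
those of the latter: `VertReach.right`, `HorReach.top`, `CornerReach.next`. Grid points carry a bit
of their own, because a path can pass through a corner into the diagonally opposite cell and touch
neither adjacent edge elsewhere.

The program sweeps the columns and stores the data of one column only, with one procedure call and a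
bounded amount of other work per cell. Its correctness is carried by the loop invariants `CellInv`
and `ColumnInv`. Since `H ≥ 1`, all overhead is absorbed into a multiple of `mf * mg * H`. -/

/-- The strict order or the weak order on the reals. -/
def OrdRel (strict : Bool) (x y : ℝ) : Prop := if strict = true then x < y else x ≤ y

namespace OrdRel

variable {b : Bool} {x y z : ℝ}

theorem of_lt (h : x < y) : OrdRel b x y := by
  cases b <;> simp [OrdRel, h, h.le]

theorem le (h : OrdRel b x y) : x ≤ y := by
  cases b <;> simp [OrdRel] at h <;> linarith

theorem trans_le (h : OrdRel b x y) (h' : y ≤ z) : OrdRel b x z := by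
  cases b <;> simp [OrdRel] at h ⊢ <;> linarith

theorem le_trans (h : x ≤ y) (h' : OrdRel b y z) : OrdRel b x z := by
  cases b <;> simp [OrdRel] at h' ⊢ <;> linarith

theorem of_sub_eq {x' y' : ℝ} (h : OrdRel b x y) (he : y' - x' = y - x) : OrdRel b x' y' := by
  cases b <;> simp [OrdRel] at h ⊢ <;> linarith

end OrdRel

/-- `a` describes a path from `p` to `q` in `F` which is (strictly, if `b` is true) increasing in
both coordinates. The path is parametrized by the sum of the two coordinates: at time `t` it is at
the point `(a t, t - a t)`. Such a path is automatically continuous. -/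
structure IsMonoPath (b : Bool) (F : Set (ℝ × ℝ)) (p q : ℝ × ℝ) (a : ℝ → ℝ) : Prop where
  le : p.1 + p.2 ≤ q.1 + q.2
  source : a (p.1 + p.2) = p.1
  target : a (q.1 + q.2) = q.1
  mem : ∀ t ∈ Icc (p.1 + p.2) (q.1 + q.2), (a t, t - a t) ∈ F
  rel : ∀ s ∈ Icc (p.1 + p.2) (q.1 + q.2), ∀ t ∈ Icc (p.1 + p.2) (q.1 + q.2), s < t →
    OrdRel b (a s) (a t) ∧ OrdRel b (s - a s) (t - a t)

/-- There is a (strictly) monotone path from `p` to `q` in `F`. -/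
def Conn (b : Bool) (F : Set (ℝ × ℝ)) (p q : ℝ × ℝ) : Prop := ∃ a, IsMonoPath b F p q a

namespace IsMonoPath

variable {b : Bool} {F : Set (ℝ × ℝ)} {p q : ℝ × ℝ} {a : ℝ → ℝ}

theorem mono_le (h : IsMonoPath b F p q a) {s t : ℝ}
    (hs : s ∈ Icc (p.1 + p.2) (q.1 + q.2)) (ht : t ∈ Icc (p.1 + p.2) (q.1 + q.2)) (hst : s ≤ t) :
    a s ≤ a t ∧ s - a s ≤ t - a t := by
  rcases hst.eq_or_lt with rfl | hlt
  · exact ⟨le_rfl, le_rfl⟩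
  · exact ⟨(h.rel s hs t ht hlt).1.le, (h.rel s hs t ht hlt).2.le⟩

/-- Both `a t` and `t - a t` are nondecreasing, so an increment of `a` lies between `0` and that of
`t`: the function is 1-Lipschitz. -/
theorem continuousOn (h : IsMonoPath b F p q a) :
    ContinuousOn a (Icc (p.1 + p.2) (q.1 + q.2)) := by
  have hl : LipschitzOnWith 1 a (Icc (p.1 + p.2) (q.1 + q.2)) := by
    refine LipschitzOnWith.of_dist_le_mul fun s hs t ht => ?_
    rw [Real.dist_eq, Real.dist_eq, NNReal.coe_one, one_mul]
    rcases le_total s t with hst | hst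
    · obtain ⟨h1, h2⟩ := h.mono_le hs ht hst
      rw [abs_le, abs_of_nonpos (by linarith)]
      constructor <;> linarith
    · obtain ⟨h1, h2⟩ := h.mono_le ht hs hst
      rw [abs_le, abs_of_nonneg (by linarith)]
      constructor <;> linarith
  exact hl.continuousOn

theorem prefix_conn (h : IsMonoPath b F p q a) {t : ℝ}
    (ht : t ∈ Icc (p.1 + p.2) (q.1 + q.2)) : Conn b F p (a t, t - a t) := by
  have e : a t + (t - a t) = t := by ring
  refine ⟨a, by simpa [e] using ht.1, h.source, by simp [e], ?_, ?_⟩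
  · intro s hs
    rw [e] at hs
    exact h.mem s ⟨hs.1, hs.2.trans ht.2⟩
  · intro s hs u hu hsu
    rw [e] at hs hu
    exact h.rel s ⟨hs.1, hs.2.trans ht.2⟩ u ⟨hu.1, hu.2.trans ht.2⟩ hsu

theorem swap (h : IsMonoPath b F p q a) :
    IsMonoPath b (Prod.swap ⁻¹' F) p.swap q.swap (fun t => t - a t) := by
  have hp : p.2 + p.1 = p.1 + p.2 := add_comm _ _
  have hq : q.2 + q.1 = q.1 + q.2 := add_comm _ _
  refine ⟨?_, ?_, ?_, ?_, ?_⟩ <;> simp only [Prod.fst_swap, Prod.snd_swap, hp, hq]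
  · exact h.le
  · rw [h.source]; ring
  · rw [h.target]; ring
  · intro t ht
    simpa using h.mem t ht
  · intro s hs t ht hst
    have := h.rel s hs t ht hst
    exact ⟨this.2, by simpa using this.1⟩

end IsMonoPath

/-! ### Elementary operations on monotone paths -/

namespace Conn

variable {b : Bool} {F G : Set (ℝ × ℝ)} {p q r : ℝ × ℝ}

theorem refl (hp : p ∈ F) : Conn b F p p := by
  refine ⟨fun _ => p.1, le_rfl, rfl, rfl, ?_, ?_⟩
  · intro t ht
    obtain rfl : t = p.1 + p.2 := le_antisymm ht.2 ht.1
    simpa using hp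
  · intro s hs t ht hst
    exact absurd hst (not_lt.2 (ht.2.trans hs.1))

theorem mono (hFG : F ⊆ G) (h : Conn b F p q) : Conn b G p q := by
  obtain ⟨a, ha⟩ := h
  exact ⟨a, ha.le, ha.source, ha.target, fun t ht => hFG (ha.mem t ht), ha.rel⟩

theorem weaken (h : Conn b F p q) : Conn false F p q := by
  obtain ⟨a, ha⟩ := h
  refine ⟨a, ha.le, ha.source, ha.target, ha.mem, fun s hs t ht hst => ?_⟩
  have := ha.mono_le hs ht hst.le
  simpa [OrdRel] using this

theorem swap (h : Conn b F p q) : Conn b (Prod.swap ⁻¹' F) p.swap q.swap := by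
  obtain ⟨a, ha⟩ := h
  exact ⟨_, ha.swap⟩

theorem swap_iff {x y x' y' : ℝ} :
    Conn b (Prod.swap ⁻¹' F) (x, y) (x', y') ↔ Conn b F (y, x) (y', x') :=
  ⟨fun h => h.swap, fun h => h.swap⟩

theorem source_mem (h : Conn b F p q) : p ∈ F := by
  obtain ⟨a, ha⟩ := h
  have := ha.mem _ (left_mem_Icc.2 ha.le)
  rw [ha.source] at this
  simpa using this

theorem target_mem (h : Conn b F p q) : q ∈ F := by
  obtain ⟨a, ha⟩ := h
  have := ha.mem _ (right_mem_Icc.2 ha.le)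
  rw [ha.target] at this
  simpa using this

theorem trans (h₁ : Conn b F p q) (h₂ : Conn b F q r) : Conn b F p r := by
  obtain ⟨a₁, k₁⟩ := h₁
  obtain ⟨a₂, k₂⟩ := h₂
  have hle := k₁.le
  have hle' := k₂.le
  refine ⟨fun t => if t ≤ q.1 + q.2 then a₁ t else a₂ t, hle.trans hle', ?_, ?_, ?_, ?_⟩
  · simp [hle, k₁.source]
  · split_ifs with hc
    · rw [le_antisymm hc hle', k₁.target]
      rw [← k₂.source, le_antisymm hle' hc, k₂.target]
    · exact k₂.target
  · intro t ht
    split_ifs with hc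
    · exact k₁.mem t ⟨ht.1, hc⟩
    · exact k₂.mem t ⟨(not_le.1 hc).le, ht.2⟩
  · intro s hs t ht hst
    split_ifs with hc hd hd
    · exact k₁.rel s ⟨hs.1, hc⟩ t ⟨ht.1, hd⟩ hst
    -- For times on both sides of the junction, the weak relation up to the junction and the strict
    -- one after it compose to a strict one.
    · have h1 := k₁.mono_le ⟨hs.1, hc⟩ (right_mem_Icc.2 hle) hc
      have h2 := k₂.rel _ (left_mem_Icc.2 hle') t ⟨(not_le.1 hd).le, ht.2⟩ (not_le.1 hd)
      rw [k₁.target] at h1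
      rw [k₂.source] at h2
      exact ⟨OrdRel.le_trans h1.1 h2.1, OrdRel.le_trans h1.2 h2.2⟩
    · exact absurd (hst.le.trans hd) hc
    · exact k₂.rel s ⟨(not_le.1 hc).le, hs.2⟩ t ⟨(not_le.1 hd).le, ht.2⟩ hst

theorem of_segment (hF : segment ℝ p q ⊆ F) (h₁ : OrdRel b p.1 q.1) (h₂ : OrdRel b p.2 q.2) :
    Conn b F p q := by
  have g₁ := h₁.le
  have g₂ := h₂.le
  rcases (add_le_add g₁ g₂).eq_or_lt with he | hlt
  · obtain rfl : p = q := Prod.ext (by linarith) (by linarith)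
    exact refl (hF (left_mem_segment ℝ p p))
  have hD : 0 < q.1 + q.2 - (p.1 + p.2) := by linarith
  set D := q.1 + q.2 - (p.1 + p.2) with hDdef
  have key : ∀ t : ℝ, t - (p.1 + (t - (p.1 + p.2)) / D * (q.1 - p.1)) =
      p.2 + (t - (p.1 + p.2)) / D * (q.2 - p.2) := by
    intro t
    have : (t - (p.1 + p.2)) / D * D = t - (p.1 + p.2) := div_mul_cancel₀ _ hD.ne'
    have e : q.2 - p.2 = D - (q.1 - p.1) := by rw [hDdef]; ring
    rw [e]; linear_combination -this
  refine ⟨fun t => p.1 + (t - (p.1 + p.2)) / D * (q.1 - p.1), hlt.le, by simp, ?_, ?_, ?_⟩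
  · simp only [← hDdef, div_self hD.ne']; ring
  · intro t ht
    refine hF ?_
    rw [segment_eq_image_lineMap]
    refine ⟨(t - (p.1 + p.2)) / D, ⟨?_, ?_⟩, ?_⟩
    · exact div_nonneg (by linarith [ht.1]) hD.le
    · rw [div_le_one hD]; linarith [ht.2]
    · refine Prod.ext ?_ ?_
      · simp [AffineMap.lineMap_apply]; ring
      · simp only [key]
        simp [AffineMap.lineMap_apply]; ring
  · intro s hs t ht hst
    have hlt' : (s - (p.1 + p.2)) / D < (t - (p.1 + p.2)) / D := by
      apply div_lt_div_of_pos_right _ hD; linarith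
    simp only [key]
    cases b
    · simp only [OrdRel, Bool.false_eq_true, if_false] at h₁ h₂ ⊢
      exact ⟨by nlinarith, by nlinarith⟩
    · simp only [OrdRel, if_true] at h₁ h₂ ⊢
      exact ⟨by nlinarith, by nlinarith⟩

end Conn

/-- A monotone path from the origin takes every intermediate value in the first coordinate. -/
theorem IsMonoPath.exists_fst_eq {b : Bool} {F : Set (ℝ × ℝ)} {q : ℝ × ℝ} {a : ℝ → ℝ}
    (h : IsMonoPath b F (0, 0) q a) {c : ℝ} (hc : 0 ≤ c) (hcq : c ≤ q.1) :
    ∃ t ∈ Icc 0 (q.1 + q.2), a t = c ∧ (c = 0 → t = 0) := by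
  have hle := h.le
  have hs := h.source
  simp only [add_zero] at hle hs
  rcases hc.eq_or_lt with rfl | hpos
  · exact ⟨0, left_mem_Icc.2 hle, hs, fun _ => rfl⟩
  · have hcont := h.continuousOn
    simp only [add_zero] at hcont
    have := intermediate_value_Icc hle hcont
    rw [hs, h.target] at this
    obtain ⟨t, ht, hat⟩ := this ⟨hc, hcq⟩
    exact ⟨t, ht, hat, fun h0 => absurd h0 hpos.ne'⟩

/-- A monotone path from the origin enters the quadrant above and to the right of `(c, d)` either
through its left or through its lower boundary. -/
theorem Conn.entry {b : Bool} {F : Set (ℝ × ℝ)} {q : ℝ × ℝ} (h : Conn b F (0, 0) q) {c d : ℝ}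
    (hc : 0 ≤ c) (hcq : c < q.1) (hd : 0 ≤ d) (hdq : d ≤ q.2) (hd' : d < q.2 ∨ d = 0) :
    (∃ y, d ≤ y ∧ OrdRel b y q.2 ∧ Conn b F (0, 0) (c, y) ∧ (c = 0 → y = 0)) ∨
    (∃ x, c ≤ x ∧ OrdRel b x q.1 ∧ OrdRel b d q.2 ∧ Conn b F (0, 0) (x, d) ∧
      (d = 0 → x = 0)) := by
  obtain ⟨a, ha⟩ := h
  have hle := ha.le
  have hsw := ha.swap
  simp only [Prod.swap_prod_mk] at hsw
  obtain ⟨t₁, ht₁, e₁, z₁⟩ := ha.exists_fst_eq hc hcq.le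
  obtain ⟨t₂, ht₂, e₂, z₂⟩ := hsw.exists_fst_eq hd hdq
  simp only [Prod.fst_swap, Prod.snd_swap, add_comm q.2 q.1] at ht₂ e₂
  have hs := ha.source
  have ht := ha.target
  have hm := ha.mono_le (s := t₁) (t := t₂)
  have hm' := ha.mono_le (s := t₂) (t := t₁)
  have hr := ha.rel
  have hp := fun t ht => ha.prefix_conn (t := t) ht
  simp only [add_zero] at hle hs hm hm' hr hp
  have hT := right_mem_Icc.2 hle
  -- Both crossing times must precede the end of the path, since the relation `OrdRel` to `q` is
  -- available for distinct times only.
  have lt₁ : t₁ < q.1 + q.2 := by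
    refine lt_of_le_of_ne ht₁.2 fun he => ?_
    rw [he, ht] at e₁
    linarith
  have lt₂ : t₂ < q.1 + q.2 := by
    refine lt_of_le_of_ne ht₂.2 fun he => ?_
    rcases hd' with hd' | hd'
    · rw [he, ht] at e₂
      linarith
    · have := z₂ hd'
      linarith
  -- Whichever of the two boundary lines is crossed last is the one through which the quadrant is
  -- entered.
  rcases le_total t₂ t₁ with h12 | h12
  · left
    refine ⟨t₁ - a t₁, ?_, ?_, ?_, ?_⟩
    · have := (hm' ht₂ ht₁ h12).2
      linarith
    · have := (hr t₁ ht₁ _ hT lt₁).2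
      rw [ht] at this
      simpa using this
    · have := hp t₁ ht₁
      rwa [e₁] at this ⊢
    · intro h0
      rw [e₁, z₁ h0, h0, sub_zero]
  · right
    refine ⟨a t₂, ?_, ?_, ?_, ?_, ?_⟩
    · have := (hm ht₁ ht₂ h12).1
      linarith
    · have := (hr t₂ ht₂ _ hT lt₂).1
      rwa [ht] at this
    · have := (hr t₂ ht₂ _ hT lt₂).2
      rw [ht, e₂] at this
      simpa using this
    · have := hp t₂ ht₂
      rwa [e₂] at this
    · intro h0
      rw [z₂ h0, hs]

/-! ### Monotone paths and the Fréchet distance -/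

theorem ordRel_true {x y : ℝ} : OrdRel true x y ↔ x < y := by simp [OrdRel]

theorem ordRel_false {x y : ℝ} : OrdRel false x y ↔ x ≤ y := by simp [OrdRel]

/-- For weak paths every defining condition is a closed condition on finitely many values of `a`, so
closedness holds in the topology of pointwise convergence. Continuity need not be imposed, being
automatic. -/
theorem isClosed_setOf_isMonoPath {F : Set (ℝ × ℝ)} (hF : IsClosed F) (p q : ℝ × ℝ) :
    IsClosed {a : ℝ → ℝ | IsMonoPath false F p q a} := by
  have : {a : ℝ → ℝ | IsMonoPath false F p q a} =
      {a | p.1 + p.2 ≤ q.1 + q.2} ∩ ({a | a (p.1 + p.2) = p.1} ∩ ({a | a (q.1 + q.2) = q.1} ∩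
      ((⋂ t ∈ Icc (p.1 + p.2) (q.1 + q.2), {a | (a t, t - a t) ∈ F}) ∩
      (⋂ s ∈ Icc (p.1 + p.2) (q.1 + q.2), ⋂ t ∈ Icc (p.1 + p.2) (q.1 + q.2), ⋂ (_ : s < t),
        {a | a s ≤ a t ∧ s - a s ≤ t - a t})))) := by
    ext a
    simp only [mem_ofPred_eq, mem_inter_iff, mem_iInter]
    constructor
    · intro h
      exact ⟨h.le, h.source, h.target, h.mem, fun s hs t ht hst => h.mono_le hs ht hst.le⟩
    · rintro ⟨h1, h2, h3, h4, h5⟩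
      exact ⟨h1, h2, h3, h4, fun s hs t ht hst => by
        simpa only [ordRel_false] using h5 s hs t ht hst⟩
  rw [this]
  refine isClosed_const.inter ((isClosed_eq (continuous_apply _) continuous_const).inter
    ((isClosed_eq (continuous_apply _) continuous_const).inter (IsClosed.inter ?_ ?_)))
  · refine isClosed_biInter fun t _ => hF.preimage (f := fun a : ℝ → ℝ => (a t, t - a t)) ?_
    fun_prop
  · refine isClosed_biInter fun s _ => isClosed_biInter fun t _ => isClosed_iInter fun _ => ?_
    have hc : ∀ t : ℝ, Continuous fun a : ℝ → ℝ => a t := fun t => continuous_apply t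
    exact (isClosed_le (hc s) (hc t)).inter
      (isClosed_le (continuous_const.sub (hc s)) (continuous_const.sub (hc t)))

/-- Weak connectedness passes to decreasing intersections of closed sets. -/
theorem Conn.iInter {F : ℕ → Set (ℝ × ℝ)} (hF : ∀ k, IsClosed (F k)) (hanti : Antitone F)
    {p q : ℝ × ℝ} (h : ∀ k, Conn false (F k) p q) : Conn false (⋂ k, F k) p q := by
  set S : ℕ → Set (ℝ → ℝ) := fun k =>
    {a | IsMonoPath false (F k) p q a} ∩ pi univ fun _ => Icc p.1 q.1 with hS
  -- Tychonoff's theorem supplies the compactness; the limit is again continuous because it is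
  -- monotone in both coordinates.
  have hpi : IsCompact (pi univ fun _ : ℝ => Icc p.1 q.1) := isCompact_univ_pi fun _ => isCompact_Icc
  have hcl : ∀ k, IsClosed (S k) := fun k =>
    (isClosed_setOf_isMonoPath (hF k) p q).inter hpi.isClosed
  have hne : (⋂ k, S k).Nonempty := by
    refine IsCompact.nonempty_iInter_of_sequence_nonempty_isCompact_isClosed S ?_ ?_
      (hpi.of_isClosed_subset (hcl 0) inter_subset_right) hcl
    · rintro k a ⟨ha, ha'⟩
      exact ⟨⟨ha.le, ha.source, ha.target, fun t ht => hanti k.le_succ (ha.mem t ht), ha.rel⟩, ha'⟩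
    · intro k
      obtain ⟨a, ha⟩ := h k
      have hpq : p.1 ≤ q.1 := by
        have := (ha.mono_le (left_mem_Icc.2 ha.le) (right_mem_Icc.2 ha.le) ha.le).1
        rwa [ha.source, ha.target] at this
      classical
      -- Values outside the time interval are arbitrary; they are reset so that the function lies in
      -- the compact box.
      refine ⟨fun t => if t ∈ Icc (p.1 + p.2) (q.1 + q.2) then a t else p.1, ?_, ?_⟩
      · refine ⟨ha.le, ?_, ?_, ?_, ?_⟩
        · rw [if_pos (left_mem_Icc.2 ha.le), ha.source]
        · rw [if_pos (right_mem_Icc.2 ha.le), ha.target]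
        · intro t ht
          rw [if_pos ht]
          exact ha.mem t ht
        · intro s hs t ht hst
          rw [if_pos hs, if_pos ht]
          exact ha.rel s hs t ht hst
      · intro t _
        simp only
        split_ifs with ht
        · have h1 := (ha.mono_le (left_mem_Icc.2 ha.le) ht ht.1).1
          have h2 := (ha.mono_le ht (right_mem_Icc.2 ha.le) ht.2).1
          rw [ha.source] at h1
          rw [ha.target] at h2
          exact ⟨h1, h2⟩
        · exact left_mem_Icc.2 hpq
  obtain ⟨a, ha⟩ := hne
  rw [mem_iInter] at ha
  have h0 := (ha 0).1
  exact ⟨a, h0.le, h0.source, h0.target,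
    fun t ht => mem_iInter.2 fun k => (ha k).1.mem t ht, h0.rel⟩

/-! ### Passing between reparametrizations and monotone paths -/

namespace IsReparam

variable {m : ℕ} {α : ℝ → ℝ}

theorem of_endpoints (hc : ContinuousOn α (Icc 0 1)) (hm : StrictMonoOn α (Icc 0 1))
    (h0 : α 0 = 0) (h1 : α 1 = m) : IsReparam m α := by
  refine ⟨hc, hm, ?_, hm.injOn, ?_⟩
  · intro t ht
    have k0 := hm.monotoneOn (left_mem_Icc.2 zero_le_one) ht ht.1
    have k1 := hm.monotoneOn ht (right_mem_Icc.2 zero_le_one) ht.2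
    rw [h0] at k0
    rw [h1] at k1
    exact ⟨k0, k1⟩
  · have := intermediate_value_Icc zero_le_one hc
    rwa [h0, h1] at this

theorem map_zero (h : IsReparam m α) : α 0 = 0 := by
  obtain ⟨t, ht, e⟩ := h.bijOn.surjOn (left_mem_Icc.2 (Nat.cast_nonneg m))
  have := h.strictMonoOn.monotoneOn (left_mem_Icc.2 zero_le_one) ht ht.1
  exact le_antisymm (this.trans e.le) (h.bijOn.mapsTo (left_mem_Icc.2 zero_le_one)).1

theorem map_one (h : IsReparam m α) : α 1 = m := by
  obtain ⟨t, ht, e⟩ := h.bijOn.surjOn (right_mem_Icc.2 (Nat.cast_nonneg m))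
  have := h.strictMonoOn.monotoneOn ht (right_mem_Icc.2 zero_le_one) ht.2
  exact le_antisymm (h.bijOn.mapsTo (right_mem_Icc.2 zero_le_one)).2 (e.ge.trans this)

theorem linear (hm : 0 < m) : IsReparam m (fun θ => m * θ) := by
  have : (0 : ℝ) < m := Nat.cast_pos.2 hm
  refine of_endpoints (by fun_prop) ?_ (by simp) (by simp)
  intro s _ t _ hst
  simp only
  gcongr

end IsReparam

/-- The sum `αf + αg` maps `[0, 1]` continuously, strictly increasingly onto `[0, mf + mg]`.
Composing `αf` with its inverse `Θ` gives the parametrization by the coordinate sum. -/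
theorem Conn.of_reparam {mf mg : ℕ} {αf αg : ℝ → ℝ} (hf : IsReparam mf αf)
    (hg : IsReparam mg αg) {F : Set (ℝ × ℝ)} (hF : ∀ θ ∈ Icc (0 : ℝ) 1, (αf θ, αg θ) ∈ F) :
    Conn true F (0, 0) ((mf : ℝ), (mg : ℝ)) := by
  have hsurj : ∀ t ∈ Icc (0 : ℝ) (mf + mg), ∃ θ ∈ Icc (0 : ℝ) 1, αf θ + αg θ = t := by
    have := intermediate_value_Icc (zero_le_one (α := ℝ)) (hf.continuousOn.add hg.continuousOn)
    simp only [Pi.add_apply, hf.map_zero, hg.map_zero, hf.map_one, hg.map_one, add_zero] at this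
    exact this
  have hmono : StrictMonoOn (fun θ => αf θ + αg θ) (Icc 0 1) :=
    fun s hs t ht hst => add_lt_add (hf.strictMonoOn hs ht hst) (hg.strictMonoOn hs ht hst)
  choose! Θ hΘ hsum using hsurj
  have hle : (0 : ℝ) ≤ mf + mg := by positivity
  have hinv : ∀ θ ∈ Icc (0 : ℝ) 1, αf θ + αg θ ∈ Icc (0 : ℝ) (mf + mg) →
      Θ (αf θ + αg θ) = θ := fun θ hθ ht =>
    hmono.injOn (hΘ _ ht) hθ (hsum _ ht)
  have hsub : ∀ t ∈ Icc (0 : ℝ) (mf + mg), t - αf (Θ t) = αg (Θ t) := fun t ht => by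
    linarith [hsum t ht]
  have z : Θ 0 = 0 := by
    have := hinv 0 (left_mem_Icc.2 zero_le_one)
    simp only [hf.map_zero, hg.map_zero, add_zero] at this
    exact this (left_mem_Icc.2 hle)
  have o : Θ (mf + mg) = 1 := by
    have := hinv 1 (right_mem_Icc.2 zero_le_one)
    simp only [hf.map_one, hg.map_one] at this
    exact this (right_mem_Icc.2 hle)
  refine ⟨fun t => αf (Θ t), ?_, ?_, ?_, ?_, ?_⟩ <;> simp only [add_zero]
  · exact hle
  · rw [z, hf.map_zero]
  · rw [o, hf.map_one]
  · intro t ht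
    rw [hsub t ht]
    exact hF _ (hΘ t ht)
  · intro s hs t ht hst
    rw [hsub s hs, hsub t ht]
    have : Θ s < Θ t := by
      rw [← hmono.lt_iff_lt (hΘ s hs) (hΘ t ht)]
      simp only [hsum s hs, hsum t ht, hst]
    exact ⟨OrdRel.of_lt (hf.strictMonoOn (hΘ s hs) (hΘ t ht) this),
      OrdRel.of_lt (hg.strictMonoOn (hΘ s hs) (hΘ t ht) this)⟩

/-- A weakly monotone path, with its two coordinates perturbed by linear functions. -/
theorem IsMonoPath.reparam_perturb {mf mg : ℕ} (hmf : 0 < mf) (hmg : 0 < mg) {b : Bool}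
    {F : Set (ℝ × ℝ)} {a : ℝ → ℝ} (ha : IsMonoPath b F (0, 0) ((mf : ℝ), (mg : ℝ)) a) {ε : ℝ}
    (hε : 0 ≤ ε) (hε1 : ε ≤ 1) (h : b = true ∨ 0 < ε) :
    IsReparam mf (fun θ => (1 - ε) * a ((mf + mg) * θ) + ε * (mf * θ)) := by
  have hF : (0 : ℝ) < mf := Nat.cast_pos.2 hmf
  have hG : (0 : ℝ) < mg := Nat.cast_pos.2 hmg
  have hmaps : MapsTo (fun θ : ℝ => (mf + mg : ℝ) * θ) (Icc 0 1) (Icc 0 (mf + mg)) := by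
    intro θ hθ
    exact ⟨by have := hθ.1; positivity, by have := hθ.2; simp only; nlinarith⟩
  have hcont := ha.continuousOn
  have hs := ha.source
  have ht := ha.target
  have hr := ha.rel
  have hmle := fun {s t : ℝ} => ha.mono_le (s := s) (t := t)
  simp only [add_zero] at hcont hs ht hr hmle
  refine IsReparam.of_endpoints ?_ ?_ ?_ ?_
  · exact (continuousOn_const.mul (hcont.comp (by fun_prop) hmaps)).add (by fun_prop)
  · intro s hs' t ht' hst
    simp only
    have hst' : (mf + mg : ℝ) * s < (mf + mg) * t := by gcongr
    have h1 := (hr _ (hmaps hs') _ (hmaps ht') hst').1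
    have h2 : (mf : ℝ) * s < mf * t := by gcongr
    rcases hε.eq_or_lt with rfl | hpos
    · rcases h with rfl | h
      · rw [ordRel_true] at h1
        linarith
      · exact absurd h (lt_irrefl _)
    · have h3 := mul_le_mul_of_nonneg_left h1.le (sub_nonneg.2 hε1)
      have h4 := mul_lt_mul_of_pos_left h2 hpos
      linarith
  · simp [hs]
  · simp only [mul_one, ht]; ring

theorem IsMonoPath.reparam_perturb_snd {mf mg : ℕ} (hmf : 0 < mf) (hmg : 0 < mg) {b : Bool}
    {F : Set (ℝ × ℝ)} {a : ℝ → ℝ} (ha : IsMonoPath b F (0, 0) ((mf : ℝ), (mg : ℝ)) a) {ε : ℝ}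
    (hε : 0 ≤ ε) (hε1 : ε ≤ 1) (h : b = true ∨ 0 < ε) :
    IsReparam mg
      (fun θ => (1 - ε) * ((mf + mg) * θ - a ((mf + mg) * θ)) + ε * (mg * θ)) := by
  have := IsMonoPath.reparam_perturb hmg hmf ha.swap hε hε1 h
  rwa [add_comm (mg : ℝ) mf] at this

/-! ### The two decision questions as reachability in the free space -/

section Polygonal

variable {n : ℕ} {χ : Seminorm ℝ (Fin n → ℝ)} {mf mg : ℕ} {f g : ℝ → Fin n → ℝ} {δ : ℝ}

/-- Continuity is meant in the product topology, in which the curves are continuous; a convex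
function on a finite-dimensional space is locally Lipschitz. -/
theorem Seminorm.continuous_pi (χ : Seminorm ℝ (Fin n → ℝ)) : Continuous χ :=
  χ.convexOn.locallyLipschitz.continuous

theorem continuousOn_deviation (hf : IsPolygonalCurve mf f) (hg : IsPolygonalCurve mg g) :
    ContinuousOn (fun p : ℝ × ℝ => χ (f p.1 - g p.2)) (Icc (0 : ℝ) mf ×ˢ Icc (0 : ℝ) mg) := by
  refine (Seminorm.continuous_pi χ).comp_continuousOn (ContinuousOn.sub ?_ ?_)
  · exact hf.continuousOn.comp continuousOn_fst fun p hp => hp.1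
  · exact hg.continuousOn.comp continuousOn_snd fun p hp => hp.2

theorem isClosed_freeSpace (hf : IsPolygonalCurve mf f) (hg : IsPolygonalCurve mg g) :
    IsClosed (freeSpace χ mf mg f g δ) := by
  have := (continuousOn_deviation (χ := χ) hf hg).preimage_isClosed_of_isClosed
    (isClosed_Icc.prod isClosed_Icc) (isClosed_Iic (a := δ))
  convert this using 1
  ext p
  exact and_assoc.symm

theorem exists_isMaxDeviation (hf : IsPolygonalCurve mf f) (hg : IsPolygonalCurve mg g)
    {αf αg : ℝ → ℝ} (h₁ : IsReparam mf αf) (h₂ : IsReparam mg αg) :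
    ∃ r, IsMaxDeviation χ f g αf αg r := by
  have hc : ContinuousOn (fun θ : ℝ => χ (f (αf θ) - g (αg θ))) (Icc (0 : ℝ) 1) :=
    (continuousOn_deviation hf hg).comp (h₁.continuousOn.prodMk h₂.continuousOn)
      fun θ hθ => ⟨h₁.bijOn.mapsTo hθ, h₂.bijOn.mapsTo hθ⟩
  exact (isCompact_Icc.image_of_continuousOn hc).exists_isGreatest
    ((nonempty_Icc.2 zero_le_one).image _)

theorem conn_of_isMaxDeviation {αf αg : ℝ → ℝ} {r : ℝ} (h₁ : IsReparam mf αf)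
    (h₂ : IsReparam mg αg) (hr : IsMaxDeviation χ f g αf αg r) (hrδ : r ≤ δ) :
    Conn true (freeSpace χ mf mg f g δ) (0, 0) ((mf : ℝ), (mg : ℝ)) :=
  Conn.of_reparam h₁ h₂ fun _ hθ =>
    ⟨h₁.bijOn.mapsTo hθ, h₂.bijOn.mapsTo hθ, (hr.2 (mem_image_of_mem _ hθ)).trans hrδ⟩

/-- There are reparametrizations with deviation at most `δ` if and only if there is a strictly
monotone path through the free space. -/
theorem exists_reparam_iff_conn (hf : IsPolygonalCurve mf f) (hg : IsPolygonalCurve mg g) :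
    (∃ (αf αg : ℝ → ℝ) (r : ℝ), IsReparam mf αf ∧ IsReparam mg αg ∧
      IsMaxDeviation χ f g αf αg r ∧ r ≤ δ) ↔
    Conn true (freeSpace χ mf mg f g δ) (0, 0) ((mf : ℝ), (mg : ℝ)) := by
  constructor
  · rintro ⟨αf, αg, r, h₁, h₂, hr, hrδ⟩
    exact conn_of_isMaxDeviation h₁ h₂ hr hrδ
  -- A strict path needs no perturbation: `ε = 0` already gives strictly increasing coordinates.
  · rintro ⟨a, ha⟩
    have k₁ := ha.reparam_perturb hf.pos hg.pos le_rfl zero_le_one (Or.inl rfl)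
    have k₂ := ha.reparam_perturb_snd hf.pos hg.pos le_rfl zero_le_one (Or.inl rfl)
    simp only [sub_zero, one_mul, zero_mul, add_zero] at k₁ k₂
    obtain ⟨r, hr⟩ := exists_isMaxDeviation (χ := χ) hf hg k₁ k₂
    refine ⟨_, _, r, k₁, k₂, hr, ?_⟩
    obtain ⟨θ, hθ, rfl⟩ := hr.1
    refine (ha.mem ((mf + mg : ℝ) * θ) ?_).2.2
    simp only [add_zero]
    exact ⟨mul_nonneg (by positivity) hθ.1, mul_le_of_le_one_right (by positivity) hθ.2⟩

theorem bddBelow_deviations : BddBelow {r : ℝ | ∃ αf αg : ℝ → ℝ,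
    IsReparam mf αf ∧ IsReparam mg αg ∧ IsMaxDeviation χ f g αf αg r} := by
  refine ⟨0, ?_⟩
  rintro r ⟨αf, αg, -, -, hr⟩
  obtain ⟨_, -, rfl⟩ := hr.1
  exact apply_nonneg χ _

/-- The Fréchet distance is at most `δ` if and only if there is a weakly monotone path through the
free space. -/
theorem frechetDist_le_iff_conn (hf : IsPolygonalCurve mf f) (hg : IsPolygonalCurve mg g) :
    frechetDist χ mf mg f g ≤ δ ↔
    Conn false (freeSpace χ mf mg f g δ) (0, 0) ((mf : ℝ), (mg : ℝ)) := by
  constructor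
  · intro h
    have hne : {r : ℝ | ∃ αf αg : ℝ → ℝ,
        IsReparam mf αf ∧ IsReparam mg αg ∧ IsMaxDeviation χ f g αf αg r}.Nonempty := by
      obtain ⟨r, hr⟩ := exists_isMaxDeviation (χ := χ) hf hg (IsReparam.linear hf.pos)
        (IsReparam.linear hg.pos)
      exact ⟨r, _, _, IsReparam.linear hf.pos, IsReparam.linear hg.pos, hr⟩
    have key : ∀ k : ℕ, Conn false (freeSpace χ mf mg f g (δ + 1 / ((k : ℝ) + 1)))
        (0, 0) ((mf : ℝ), (mg : ℝ)) := by
      intro k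
      have hpos : (0 : ℝ) < 1 / ((k : ℝ) + 1) := by positivity
      obtain ⟨r, ⟨αf, αg, h₁, h₂, hr⟩, hlt⟩ := exists_lt_of_csInf_lt hne
        (show sInf _ < δ + 1 / ((k : ℝ) + 1) from lt_of_le_of_lt h (by linarith))
      exact (conn_of_isMaxDeviation h₁ h₂ hr hlt.le).weaken
    refine (Conn.iInter (fun k => isClosed_freeSpace hf hg) ?_ key).mono ?_
    · intro k l hkl p hp
      refine ⟨hp.1, hp.2.1, hp.2.2.trans ?_⟩
      have : (1 : ℝ) / ((l : ℝ) + 1) ≤ 1 / ((k : ℝ) + 1) := Nat.one_div_le_one_div hkl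
      linarith
    · intro p hp
      rw [mem_iInter] at hp
      refine ⟨(hp 0).1, (hp 0).2.1, ?_⟩
      refine le_of_forall_pos_lt_add fun ε hε => ?_
      obtain ⟨k, hk⟩ := exists_nat_one_div_lt hε
      linarith [(hp k).2.2]
  · rintro ⟨a, ha⟩
    refine le_of_forall_pos_le_add fun η hη => ?_
    have huc := (isCompact_Icc.prod isCompact_Icc).uniformContinuousOn_of_continuous
      (continuousOn_deviation (χ := χ) hf hg)
    rw [Metric.uniformContinuousOn_iff] at huc
    obtain ⟨d, hd, huc⟩ := huc η hη
    have hM : (0 : ℝ) < mf + mg + 1 := by positivity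
    -- The perturbation moves each coordinate by at most `ε * (mf + mg + 1)`, which this choice
    -- keeps below the modulus `d` of uniform continuity.
    set ε : ℝ := min 1 (d / (mf + mg + 1) / 2) with hεdef
    have hε : 0 < ε := lt_min one_pos (by positivity)
    have hεd : ε * (mf + mg + 1) < d := by
      have h1 : ε ≤ d / (mf + mg + 1) / 2 := min_le_right _ _
      have h2 : d / (mf + mg + 1) / 2 * (mf + mg + 1) = d / 2 := by field_simp
      have := mul_le_mul_of_nonneg_right h1 hM.le
      linarith
    have k₁ := ha.reparam_perturb hf.pos hg.pos hε.le (min_le_left _ _) (Or.inr hε)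
    have k₂ := ha.reparam_perturb_snd hf.pos hg.pos hε.le (min_le_left _ _) (Or.inr hε)
    obtain ⟨r, hr⟩ := exists_isMaxDeviation (χ := χ) hf hg k₁ k₂
    refine (csInf_le bddBelow_deviations ⟨_, _, k₁, k₂, hr⟩).trans ?_
    obtain ⟨θ, hθ, rfl⟩ := hr.1
    have hmem := ha.mem ((mf + mg : ℝ) * θ) (by
      simp only [add_zero]
      exact ⟨mul_nonneg (by positivity) hθ.1, mul_le_of_le_one_right (by positivity) hθ.2⟩)
    have m₁ := k₁.bijOn.mapsTo hθ
    have m₂ := k₂.bijOn.mapsTo hθ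
    have close : ∀ {m : ℕ} {u : ℝ}, u ∈ Icc (0 : ℝ) m → (m : ℝ) ≤ mf + mg →
        |(1 - ε) * u + ε * (m * θ) - u| < d := by
      intro m u hu hm
      have e : (1 - ε) * u + ε * (m * θ) - u = ε * (m * θ - u) := by ring
      have h1 : (m : ℝ) * θ ≤ m := mul_le_of_le_one_right (by positivity) hθ.2
      have h2 : 0 ≤ (m : ℝ) * θ := mul_nonneg (by positivity) hθ.1
      have h3 : |(m : ℝ) * θ - u| ≤ mf + mg + 1 := by
        rw [abs_le]
        constructor <;> linarith [hu.1, hu.2]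
      rw [e, abs_mul, abs_of_pos hε]
      exact (mul_le_mul_of_nonneg_left h3 hε.le).trans_lt hεd
    have := huc (_, _) ⟨m₁, m₂⟩ _ ⟨hmem.1, hmem.2.1⟩ (by
      rw [Prod.dist_eq, max_lt_iff, Real.dist_eq, Real.dist_eq]
      exact ⟨close hmem.1 (by simp), close hmem.2.1 (by simp)⟩)
    rw [Real.dist_eq] at this
    have := (abs_lt.1 this).2
    have h3 := hmem.2.2
    simp only at this h3 ⊢
    linarith

end Polygonal

/-! ### Propagation of reachability through a cell -/

/-- The square `[i, i + 1] × [j, j + 1]`. -/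
def gridCell (i j : ℕ) : Set (ℝ × ℝ) := Icc (i : ℝ) (i + 1) ×ˢ Icc (j : ℝ) (j + 1)

/-- `lo` describes the points reachable from the origin on the vertical edge from `(i, j)` to
`(i, j + 1)` without its upper end: it is their infimum, attained for weak paths, and at least `1`
if there are none. On the left boundary only the origin is considered. -/
structure VertReach (b : Bool) (F : Set (ℝ × ℝ)) (i j : ℕ) (lo : ℝ) : Prop where
  nonneg : 0 ≤ lo
  sound : lo < 1 → ∀ u, OrdRel b lo u →
    ∃ s, 0 ≤ s ∧ s < 1 ∧ OrdRel b s u ∧ Conn b F (0, 0) ((i : ℝ), j + s)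
  complete : ∀ s, 0 ≤ s → s < 1 → (i = 0 → j = 0 ∧ s = 0) →
    Conn b F (0, 0) ((i : ℝ), j + s) → lo ≤ s

/-- The analogue of `VertReach` for the horizontal edge from `(i, j)` to `(i + 1, j)`. -/
def HorReach (b : Bool) (F : Set (ℝ × ℝ)) (i j : ℕ) (lo : ℝ) : Prop :=
  VertReach b (Prod.swap ⁻¹' F) j i lo

/-- `c` says whether the grid point `(i, j)` is reachable from the origin; nothing but soundness is
demanded on the left and lower boundary. -/
structure CornerReach (b : Bool) (F : Set (ℝ × ℝ)) (i j : ℕ) (c : Prop) : Prop where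
  sound : c → Conn b F (0, 0) ((i : ℝ), (j : ℝ))
  complete : 0 < i → 0 < j → Conn b F (0, 0) ((i : ℝ), (j : ℝ)) → c

/-- `flag, x, y` describe the subset `E` of the line: it is empty and `flag = 0`, or `flag = 1` and
`x`, `y` are its extreme points. -/
def IsExtent (E : Set ℝ) (flag : ℕ) (x y : ℝ) : Prop :=
  (flag = 0 ∧ E = ∅) ∨ (flag = 1 ∧ IsLeast E x ∧ IsGreatest E y)

/-- The part of the right edge of a cell which lies in `F`. -/
def rightEdge (F : Set (ℝ × ℝ)) (i j : ℕ) : Set ℝ :=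
  {s | s ∈ Icc (0 : ℝ) 1 ∧ ((i : ℝ) + 1, (j : ℝ) + s) ∈ F}

open Classical in
/-- The first reachable point of an edge with extent `flag, x, y`, when exactly the points beyond
`l` can be reached. -/
noncomputable def exitLo (b : Bool) (flag : ℕ) (x y l : ℝ) : ℝ :=
  if 0 < flag ∧ OrdRel b l y then max x l else 1

open Classical in
/-- The reachability of the opposite edge, from that of the edges `lo₁` (opposite) and `lo₂`
(adjacent) and that of the common end point `c` of the edge and the adjacent edge. -/
noncomputable def edgeLo (b : Bool) (flag : ℕ) (x y lo₁ lo₂ : ℝ) (c : Prop) : ℝ :=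
  if c then 0 else exitLo b flag x y (if 1 ≤ lo₂ then lo₁ else 0)

/-- Whether the upper right corner of a cell is reachable. -/
def cornerBit (b : Bool) (flag : ℕ) (y lo₁ lo₂ : ℝ) (c₁ c₂ : Prop) : Prop :=
  (lo₁ < 1 ∨ lo₂ < 1 ∨ (b = false ∧ (c₁ ∨ c₂))) ∧ 0 < flag ∧ 1 ≤ y

/-! ### One cell: reachability of the right edge, the top edge and the upper right corner -/

section

variable {b : Bool} {F : Set (ℝ × ℝ)} {i j : ℕ} {lo lo₁ lo₂ : ℝ} {c c₁ c₂ : Prop}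

theorem CornerReach.swap (h : CornerReach b F i j c) :
    CornerReach b (Prod.swap ⁻¹' F) j i c :=
  ⟨fun hc => Conn.swap_iff.2 (h.sound hc), fun hj hi hc => h.complete hi hj (Conn.swap_iff.1 hc)⟩

theorem VertReach.swap (h : VertReach b F i j lo) : HorReach b (Prod.swap ⁻¹' F) j i lo := h

theorem HorReach.sound (h : HorReach b F i j lo) (hlo : lo < 1) {u : ℝ} (hu : OrdRel b lo u) :
    ∃ s, 0 ≤ s ∧ s < 1 ∧ OrdRel b s u ∧ Conn b F (0, 0) ((i : ℝ) + s, (j : ℝ)) := by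
  obtain ⟨s, h0, h1, hs, hc⟩ := VertReach.sound h hlo u hu
  exact ⟨s, h0, h1, hs, Conn.swap_iff.1 hc⟩

theorem HorReach.complete (h : HorReach b F i j lo) {s : ℝ} (h0 : 0 ≤ s) (h1 : s < 1)
    (hj : j = 0 → i = 0 ∧ s = 0) (hc : Conn b F (0, 0) ((i : ℝ) + s, (j : ℝ))) : lo ≤ s :=
  VertReach.complete h s h0 h1 hj (Conn.swap_iff.2 hc)

/-- By convexity the segment from `p` to `q` stays in `F`. This is the only way in which paths are
prolonged inside a cell. -/
theorem Conn.step (hF : Convex ℝ (F ∩ gridCell i j)) {o p q : ℝ × ℝ} (h : Conn b F o p)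
    (hp : p ∈ gridCell i j) (hq : q ∈ gridCell i j) (hqF : q ∈ F) (h₁ : OrdRel b p.1 q.1)
    (h₂ : OrdRel b p.2 q.2) : Conn b F o q :=
  h.trans (Conn.of_segment
    ((hF.segment_subset ⟨h.target_mem, hp⟩ ⟨hqF, hq⟩).trans inter_subset_left) h₁ h₂)

theorem mem_gridCell {x y : ℝ} : (x, y) ∈ gridCell i j ↔
    ((i : ℝ) ≤ x ∧ x ≤ i + 1) ∧ ((j : ℝ) ≤ y ∧ y ≤ j + 1) := Iff.rfl

/-- Points which can be reached on the left edge are connected to those above them on the right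
edge. -/
theorem VertReach.conn_right (hF : Convex ℝ (F ∩ gridCell i j)) (h : VertReach b F i j lo)
    (hlo : lo < 1) {s : ℝ} (hs : s ∈ rightEdge F i j) (hr : OrdRel b lo s) :
    Conn b F (0, 0) ((i : ℝ) + 1, (j : ℝ) + s) := by
  obtain ⟨u, u0, u1, hu, hc⟩ := h.sound hlo s hr
  obtain ⟨⟨s0, s1⟩, hsF⟩ := hs
  refine hc.step hF ?_ ?_ hsF (OrdRel.of_lt (by simp)) (hu.of_sub_eq (by ring))
  · rw [mem_gridCell]; constructor <;> constructor <;> linarith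
  · rw [mem_gridCell]; constructor <;> constructor <;> linarith

/-- A reachable point before the right end of the lower edge lies strictly to the left of the whole
right edge. Its position is therefore immaterial, and the threshold on the right edge is `0`, which
is why `edgeLo` only asks whether `lo₂` is below `1`. -/
theorem HorReach.conn_right (hF : Convex ℝ (F ∩ gridCell i j)) (h : HorReach b F i j lo)
    (hlo : lo < 1) {s : ℝ} (hs : s ∈ rightEdge F i j) (hr : OrdRel b 0 s) :
    Conn b F (0, 0) ((i : ℝ) + 1, (j : ℝ) + s) := by
  obtain ⟨u, u0, u1, hu, hc⟩ := h.sound hlo (OrdRel.of_lt hlo)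
  obtain ⟨⟨s0, s1⟩, hsF⟩ := hs
  refine hc.step hF ?_ ?_ hsF (hu.of_sub_eq (by ring)) (hr.of_sub_eq (by ring))
  · rw [mem_gridCell]; constructor <;> constructor <;> linarith
  · rw [mem_gridCell]; constructor <;> constructor <;> linarith

theorem IsExtent.pos_of_mem {E : Set ℝ} {flag : ℕ} {x y s : ℝ} (h : IsExtent E flag x y)
    (hs : s ∈ E) : 0 < flag ∧ x ≤ s ∧ s ≤ y := by
  rcases h with ⟨-, rfl⟩ | ⟨rfl, hx, hy⟩
  · exact absurd hs (notMem_empty s)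
  · exact ⟨one_pos, hx.2 hs, hy.2 hs⟩

theorem IsExtent.mem {E : Set ℝ} {flag : ℕ} {x y : ℝ} (h : IsExtent E flag x y)
    (hflag : 0 < flag) : x ∈ E ∧ y ∈ E := by
  rcases h with ⟨rfl, -⟩ | ⟨rfl, hx, hy⟩
  · exact absurd hflag (lt_irrefl 0)
  · exact ⟨hx.1, hy.1⟩

theorem convex_rightEdge (hF : Convex ℝ (F ∩ gridCell i j)) : Convex ℝ (rightEdge F i j) := by
  intro s hs t ht α β hα hβ hαβ
  have hcell : ∀ u ∈ Icc (0 : ℝ) 1, ((i : ℝ) + 1, (j : ℝ) + u) ∈ gridCell i j := fun u hu => by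
    rw [mem_gridCell]; constructor <;> constructor <;> linarith [hu.1, hu.2]
  refine ⟨convex_Icc 0 1 hs.1 ht.1 hα hβ hαβ, ?_⟩
  have := (hF ⟨hs.2, hcell s hs.1⟩ ⟨ht.2, hcell t ht.1⟩ hα hβ hαβ).1
  convert this using 1
  refine Prod.ext ?_ ?_
  · simp only [Prod.smul_mk, Prod.mk_add_mk, smul_eq_mul, ← add_mul, hαβ, one_mul]
  · simp only [Prod.smul_mk, Prod.mk_add_mk, smul_eq_mul]
    linear_combination (-(j : ℝ)) * hαβ

/-- If exactly the points of the edge beyond `l` can be reached, then `exitLo` is approached by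
reachable points. -/
theorem exists_of_exitLo_lt {E : Set ℝ} (hE : Convex ℝ E) {flag : ℕ}
    {x y l : ℝ} (hext : IsExtent E flag x y) (hlt : exitLo b flag x y l < 1) {u : ℝ}
    (hu : OrdRel b (exitLo b flag x y l) u) :
    l < 1 ∧ ∃ s ∈ E, s < 1 ∧ OrdRel b s u ∧ OrdRel b l s := by
  unfold exitLo at hlt hu
  split_ifs at hlt hu with h
  · obtain ⟨hx, hy⟩ := hext.mem h.1
    have hxy := (hext.pos_of_mem hx).2.2
    have hl : l < 1 := (le_max_right _ _).trans_lt hlt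
    have hx1 : x < 1 := (le_max_left _ _).trans_lt hlt
    have hlu := hu.le_trans (le_max_right x l)
    have hxu := hu.le_trans (le_max_left x l)
    refine ⟨hl, ?_⟩
    by_cases hlx : OrdRel b l x
    · exact ⟨x, hx, hx1, hxu, hlx⟩
    cases b
    · rw [ordRel_false] at *
      have hxl : x < l := not_le.1 hlx
      exact ⟨l, hE.ordConnected.out hx hy ⟨hxl.le, h.2⟩, hl, by rwa [ordRel_false],
        by rw [ordRel_false]⟩
    · rw [ordRel_true] at *
      have hxl : x ≤ l := not_lt.1 hlx
      -- In the strict case `l` itself is not allowed, but points slightly beyond it are: the free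
      -- part reaches past `l`, since `l < y`.
      obtain ⟨s, hs₁, hs₂⟩ := exists_between (lt_min hlu (lt_min hl h.2))
      have hs₃ := lt_min_iff.1 hs₂
      have hs₄ := lt_min_iff.1 hs₃.2
      exact ⟨s, hE.ordConnected.out hx hy ⟨by linarith, hs₄.2.le⟩, hs₄.1,
        ordRel_true.2 hs₃.1, ordRel_true.2 hs₁⟩
  · exact absurd hlt (lt_irrefl 1)

theorem exitLo_le {E : Set ℝ} {flag : ℕ} {x y l s : ℝ} (hext : IsExtent E flag x y) (hs : s ∈ E)
    (hl : OrdRel b l s) : exitLo b flag x y l ≤ s := by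
  obtain ⟨hflag, hxs, hsy⟩ := hext.pos_of_mem hs
  unfold exitLo
  rw [if_pos ⟨hflag, hl.trans_le hsy⟩]
  exact max_le hxs hl.le

theorem exitLo_nonneg {flag : ℕ} {x y l : ℝ} (hl : 0 ≤ l) : 0 ≤ exitLo b flag x y l := by
  unfold exitLo
  split_ifs
  exacts [hl.trans (le_max_right _ _), zero_le_one]

theorem nat_zero_of_le {y : ℝ} (hj : (j : ℝ) ≤ y) (hy : y = 0) : j = 0 := by
  have : (j : ℝ) ≤ 0 := hj.trans hy.le
  exact_mod_cast le_antisymm this (Nat.cast_nonneg j)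

/-- The reachability of the right edge of a cell. -/
theorem VertReach.right (hF : Convex ℝ (F ∩ gridCell i j)) {flag : ℕ} {x y : ℝ}
    (hext : IsExtent (rightEdge F i j) flag x y) (hL : VertReach b F i j lo₁)
    (hB : HorReach b F i j lo₂) (hc : CornerReach b F (i + 1) j c) :
    VertReach b F (i + 1) j (edgeLo b flag x y lo₁ lo₂ c) := by
  refine ⟨?_, ?_, ?_⟩
  · unfold edgeLo
    split_ifs
    exacts [le_rfl, exitLo_nonneg hL.nonneg, exitLo_nonneg le_rfl]
  · intro hlt u hu
    unfold edgeLo at hlt hu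
    split_ifs at hlt hu with h₁ h₂
    · exact ⟨0, le_rfl, zero_lt_one, hu, by simpa using hc.sound h₁⟩
    · obtain ⟨hl, s, hs, hs1, hsu, hls⟩ :=
        exists_of_exitLo_lt (convex_rightEdge hF) hext hlt hu
      refine ⟨s, hs.1.1, hs1, hsu, ?_⟩
      simpa using hL.conn_right hF hl hs hls
    · obtain ⟨hl, s, hs, hs1, hsu, hls⟩ :=
        exists_of_exitLo_lt (convex_rightEdge hF) hext hlt hu
      refine ⟨s, hs.1.1, hs1, hsu, ?_⟩
      simpa using hB.conn_right hF (not_le.1 h₂) hs hls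
  · intro s s0 s1 _ hconn
    unfold edgeLo
    by_cases h₁ : c
    · rwa [if_pos h₁]
    rw [if_neg h₁]
    push_cast at hconn
    have hs : s ∈ rightEdge F i j := ⟨⟨s0, s1.le⟩, hconn.target_mem⟩
    refine exitLo_le hext hs ?_
    -- With `s = 0` and `j > 0` the point is the lower right corner, whose bit `c` has been
    -- excluded.
    have hd : (j : ℝ) < j + s ∨ (j : ℝ) = 0 := by
      by_contra! hcon
      have hs0 : s = 0 := by linarith
      have hj : 0 < j := Nat.pos_of_ne_zero (by simpa using hcon.2)
      exact h₁ (hc.complete i.succ_pos hj (by simpa [hs0] using hconn))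
    rcases hconn.entry (Nat.cast_nonneg i) (by simp) (Nat.cast_nonneg j) (by simpa using s0) hd with
      ⟨v, hjv, hvs, hv, hv0⟩ | ⟨v, hiv, hvs, hjs, hv, hv0⟩
    · have hlo : lo₁ ≤ v - j := by
        refine hL.complete _ (by linarith) ?_ ?_ (by simpa using hv)
        · have := hvs.le
          simp only at this
          linarith
        · rintro rfl
          have := hv0 (by simp)
          have hj := nat_zero_of_le hjv this
          exact ⟨hj, by simp [this, hj]⟩
      have hvs' : OrdRel b (v - j) s := hvs.of_sub_eq (by ring)
      refine OrdRel.le_trans ?_ hvs'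
      split_ifs
      · exact hlo
      · linarith
    · have h0s : OrdRel b 0 s := hjs.of_sub_eq (by ring)
      simp only at hvs
      -- Equality means that the path comes through the lower right corner. For `j > 0` this
      -- contradicts `¬ c`; for `j = 0` the entry point is the origin, which is not that corner.
      rcases hvs.le.eq_or_lt with he | hlt
      · exfalso
        rcases j.eq_zero_or_pos with rfl | hj
        · have := hv0 (by simp)
          have hi : (0 : ℝ) ≤ i := Nat.cast_nonneg i
          linarith
        · exact h₁ (hc.complete i.succ_pos hj (by rw [he] at hv; simpa using hv))
      · have hlo : lo₂ ≤ v - i := by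
          refine hB.complete (by linarith) (by linarith) ?_ (by simpa using hv)
          rintro rfl
          have := hv0 (by simp)
          have hi := nat_zero_of_le hiv this
          exact ⟨hi, by simp [this, hi]⟩
        rw [if_neg (by linarith)]
        exact h0s

theorem convex_swap (hF : Convex ℝ (F ∩ gridCell i j)) :
    Convex ℝ (Prod.swap ⁻¹' F ∩ gridCell j i) := by
  intro p hp q hq α β hα hβ hαβ
  have hsw : ∀ p : ℝ × ℝ, p ∈ Prod.swap ⁻¹' F ∩ gridCell j i → p.swap ∈ F ∩ gridCell i j :=
    fun p hp => ⟨hp.1, hp.2.2, hp.2.1⟩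
  have := hF (hsw p hp) (hsw q hq) hα hβ hαβ
  exact ⟨this.1, this.2.2, this.2.1⟩

/-- The reachability of the top edge of a cell. -/
theorem HorReach.top (hF : Convex ℝ (F ∩ gridCell i j)) {flag : ℕ} {x y : ℝ}
    (hext : IsExtent {s | s ∈ Icc (0 : ℝ) 1 ∧ ((i : ℝ) + s, (j : ℝ) + 1) ∈ F} flag x y)
    (hL : VertReach b F i j lo₁) (hB : HorReach b F i j lo₂) (hc : CornerReach b F i (j + 1) c) :
    HorReach b F i (j + 1) (edgeLo b flag x y lo₂ lo₁ c) :=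
  VertReach.right (convex_swap hF) hext hB hL.swap hc.swap

/-- The reachability of the upper right corner of a cell. -/
theorem CornerReach.next (hF : Convex ℝ (F ∩ gridCell i j)) {flag : ℕ} {x y : ℝ}
    (hext : IsExtent (rightEdge F i j) flag x y) (hL : VertReach b F i j lo₁)
    (hB : HorReach b F i j lo₂) (hc₁ : CornerReach b F (i + 1) j c₁)
    (hc₂ : CornerReach b F i (j + 1) c₂) :
    CornerReach b F (i + 1) (j + 1) (cornerBit b flag y lo₁ lo₂ c₁ c₂) := by
  constructor
  · rintro ⟨hentry, hflag, hy1⟩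
    have hy := (hext.mem hflag).2
    have h1 : (1 : ℝ) ∈ rightEdge F i j := by rwa [le_antisymm hy1 hy.1.2]
    push_cast
    rcases hentry with h | h | ⟨rfl, h | h⟩
    · exact hL.conn_right hF h h1 (OrdRel.of_lt h)
    · exact hB.conn_right hF h h1 (OrdRel.of_lt zero_lt_one)
    · refine (hc₁.sound h).step hF ?_ ?_ h1.2 (ordRel_false.2 (by simp)) (ordRel_false.2 (by simp))
      · push_cast; rw [mem_gridCell]; constructor <;> constructor <;> linarith
      · rw [mem_gridCell]; constructor <;> constructor <;> linarith
    · refine (hc₂.sound h).step hF ?_ ?_ h1.2 (ordRel_false.2 (by simp)) (ordRel_false.2 (by simp))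
      · push_cast; rw [mem_gridCell]; constructor <;> constructor <;> linarith
      · rw [mem_gridCell]; constructor <;> constructor <;> linarith
  · intro _ _ hconn
    push_cast at hconn
    have h1 : (1 : ℝ) ∈ rightEdge F i j := ⟨⟨zero_le_one, le_rfl⟩, hconn.target_mem⟩
    obtain ⟨hflag, -, h1y⟩ := hext.pos_of_mem h1
    refine ⟨?_, hflag, h1y⟩
    -- An entry at the lower right or upper left corner forces a purely vertical or horizontal last
    -- piece, which only weak paths may have.
    have weak : ∀ {u v : ℝ}, OrdRel b u v → u = v → b = false := by
      intro u v h he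
      cases b
      · rfl
      · exact absurd he (ordRel_true.1 h).ne
    rcases hconn.entry (Nat.cast_nonneg i) (by simp) (Nat.cast_nonneg j) (by simp)
        (Or.inl (by simp)) with
      ⟨v, hjv, hvs, hv, hv0⟩ | ⟨v, hiv, hvs, hjs, hv, hv0⟩
    · simp only at hvs
      rcases hvs.le.eq_or_lt with he | hlt
      · refine Or.inr (Or.inr ⟨weak hvs he, Or.inr ?_⟩)
        refine hc₂.complete (Nat.pos_of_ne_zero ?_) j.succ_pos (by rw [he] at hv; simpa using hv)
        rintro rfl
        have := hv0 (by simp)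
        have hj : (0 : ℝ) ≤ j := Nat.cast_nonneg j
        linarith
      · left
        refine (hL.complete (v - j) (by linarith) (by linarith) ?_ (by simpa using hv)).trans_lt
          (by linarith)
        rintro rfl
        have := hv0 (by simp)
        have hj := nat_zero_of_le hjv this
        exact ⟨hj, by simp [this, hj]⟩
    · simp only at hvs
      rcases hvs.le.eq_or_lt with he | hlt
      · refine Or.inr (Or.inr ⟨weak hvs he, Or.inl ?_⟩)
        refine hc₁.complete i.succ_pos (Nat.pos_of_ne_zero ?_) (by rw [he] at hv; simpa using hv)
        rintro rfl
        have := hv0 (by simp)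
        have hi : (0 : ℝ) ≤ i := Nat.cast_nonneg i
        linarith
      · right; left
        refine (hB.complete (s := v - i) (by linarith) (by linarith) ?_ (by simpa using hv)).trans_lt
          (by linarith)
        rintro rfl
        have := hv0 (by simp)
        have hi := nat_zero_of_le hiv this
        exact ⟨hi, by simp [this, hi]⟩

/-- The reachability of the lowest edge on the left boundary. -/
theorem VertReach.origin (h : lo = 0 ∧ (0, 0) ∈ F ∨ lo = 1 ∧ (0, 0) ∉ F) :
    VertReach b F 0 0 lo := by
  rcases h with ⟨rfl, h⟩ | ⟨rfl, h⟩
  · refine ⟨le_rfl, fun _ u hu => ⟨0, le_rfl, zero_lt_one, hu, ?_⟩, fun s hs _ _ _ => hs⟩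
    simpa using Conn.refl h
  · refine ⟨zero_le_one, fun h1 => absurd h1 (lt_irrefl 1), fun s _ _ _ hc => ?_⟩
    exact absurd hc.source_mem h

theorem HorReach.origin (h : lo = 0 ∧ (0, 0) ∈ F ∨ lo = 1 ∧ (0, 0) ∉ F) :
    HorReach b F 0 0 lo := VertReach.origin h

/-- On the left boundary only the origin is considered. -/
theorem VertReach.boundary (hj : 0 < j) : VertReach b F 0 j 1 :=
  ⟨zero_le_one, fun h1 => absurd h1 (lt_irrefl 1), fun _ _ _ h _ => absurd (h rfl).1 hj.ne'⟩

theorem HorReach.boundary (hi : 0 < i) : HorReach b F i 0 1 := VertReach.boundary hi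

/-- Nothing is lost by ignoring these grid points: a weak path that climbs the left boundary is
recorded at the left ends of the horizontal edges it meets. -/
theorem CornerReach.left_boundary : CornerReach b F 0 j False :=
  ⟨False.elim, fun h => absurd h (lt_irrefl 0)⟩

theorem CornerReach.lower_boundary : CornerReach b F i 0 False :=
  ⟨False.elim, fun _ h => absurd h (lt_irrefl 0)⟩

end

/-! ### Convexity of the free space in a cell -/

section

variable {n : ℕ} {χ : Seminorm ℝ (Fin n → ℝ)} {mf mg : ℕ} {f g : ℝ → Fin n → ℝ} {δ : ℝ}

theorem IsPolygonalCurve.affine_on (hf : IsPolygonalCurve mf f) {i : ℕ} (hi : i < mf) {x y α β : ℝ}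
    (hx : x ∈ Icc (i : ℝ) (i + 1)) (hy : y ∈ Icc (i : ℝ) (i + 1)) (hα : 0 ≤ α) (hβ : 0 ≤ β)
    (hαβ : α + β = 1) : f (α * x + β * y) = α • f x + β • f y := by
  have key : ∀ z ∈ Icc (i : ℝ) (i + 1),
      f z = (1 - (z - i)) • f (i : ℝ) + (z - i) • f ((i : ℝ) + 1) := fun z hz => by
    have := hf.interp i hi (z - i) ⟨by linarith [hz.1], by linarith [hz.2]⟩
    rwa [add_sub_cancel] at this
  have hz : α * x + β * y ∈ Icc (i : ℝ) (i + 1) := convex_Icc _ _ hx hy hα hβ hαβ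
  rw [key _ hz, key x hx, key y hy]
  obtain rfl : α = 1 - β := by linarith
  module

/-- The free space is convex in each cell. -/
theorem convex_freeSpace_inter_gridCell (hf : IsPolygonalCurve mf f) (hg : IsPolygonalCurve mg g)
    {i j : ℕ} (hi : i < mf) (hj : j < mg) :
    Convex ℝ (freeSpace χ mf mg f g δ ∩ gridCell i j) := by
  rintro p ⟨hp, hpc⟩ q ⟨hq, hqc⟩ α β hα hβ hαβ
  refine ⟨⟨convex_Icc _ _ hp.1 hq.1 hα hβ hαβ, convex_Icc _ _ hp.2.1 hq.2.1 hα hβ hαβ, ?_⟩,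
    convex_Icc _ _ hpc.1 hqc.1 hα hβ hαβ, convex_Icc _ _ hpc.2 hqc.2 hα hβ hαβ⟩
  simp only [Prod.fst_add, Prod.snd_add, Prod.smul_fst, Prod.smul_snd, smul_eq_mul]
  rw [hf.affine_on hi hpc.1 hqc.1 hα hβ hαβ, hg.affine_on hj hpc.2 hqc.2 hα hβ hαβ]
  -- The difference of the curves is affine in both parameters jointly, so the triangle inequality
  -- for `χ` finishes.
  have e : α • f p.1 + β • f q.1 - (α • g p.2 + β • g q.2) =
      α • (f p.1 - g p.2) + β • (f q.1 - g q.2) := by module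
  rw [e]
  calc χ (α • (f p.1 - g p.2) + β • (f q.1 - g q.2))
      ≤ χ (α • (f p.1 - g p.2)) + χ (β • (f q.1 - g q.2)) := map_add_le_add χ _ _
    _ = α * χ (f p.1 - g p.2) + β * χ (f q.1 - g q.2) := by
        rw [map_smul_eq_mul, map_smul_eq_mul, Real.norm_of_nonneg hα, Real.norm_of_nonneg hβ]
    _ ≤ α * δ + β * δ := by
        gcongr
        exacts [hp.2.2, hq.2.2]
    _ = δ := by rw [← add_mul, hαβ, one_mul]

end

/-! ### The algorithm -/

namespace RealRAM

infixr:60 " ;; " => Program.seq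

/-- `p`, started with memory `s`, halts with memory `s'` after at most `T` steps. -/
def RunsTo (op : ℕ → ℝ → ℝ → ℝ) (inp : Input) (body p : Program) (s s' : State) (T : ℕ) : Prop :=
  ∃ t ≤ T, Exec op inp body p s s' t

/-- The memory `s` after an assignment to a natural register. -/
def State.setNat (s : State) (x v : ℕ) : State := { s with nat := Function.update s.nat x v }

/-- The memory `s` after an assignment to a real register. -/
def State.setReal (s : State) (x : ℕ) (v : ℝ) : State :=
  { s with real := Function.update s.real x v }

/-- The memory `s` after an assignment to an entry of a natural array. -/
def State.setNatArr (s : State) (a y v : ℕ) : State :=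
  { s with natArr := Function.update s.natArr a (Function.update (s.natArr a) y v) }

/-- The memory `s` after an assignment to an entry of a real array. -/
def State.setRealArr (s : State) (a y : ℕ) (v : ℝ) : State :=
  { s with realArr := Function.update s.realArr a (Function.update (s.realArr a) y v) }

section

variable (s : State) (x y z a v : ℕ) (r : ℝ)

@[simp] theorem setNat_nat : (s.setNat x v).nat y = if y = x then v else s.nat y :=
  Function.update_apply ..
@[simp] theorem setNat_real : (s.setNat x v).real = s.real := rfl
@[simp] theorem setNat_natArr : (s.setNat x v).natArr = s.natArr := rfl
@[simp] theorem setNat_realArr : (s.setNat x v).realArr = s.realArr := rfl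
@[simp] theorem setReal_real : (s.setReal x r).real y = if y = x then r else s.real y :=
  Function.update_apply ..
@[simp] theorem setReal_nat : (s.setReal x r).nat = s.nat := rfl
@[simp] theorem setReal_natArr : (s.setReal x r).natArr = s.natArr := rfl
@[simp] theorem setReal_realArr : (s.setReal x r).realArr = s.realArr := rfl
@[simp] theorem setNatArr_nat : (s.setNatArr a y v).nat = s.nat := rfl
@[simp] theorem setNatArr_real : (s.setNatArr a y v).real = s.real := rfl
@[simp] theorem setNatArr_realArr : (s.setNatArr a y v).realArr = s.realArr := rfl
@[simp] theorem setNatArr_natArr : (s.setNatArr a y v).natArr =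
    Function.update s.natArr a (Function.update (s.natArr a) y v) := rfl
@[simp] theorem setRealArr_nat : (s.setRealArr a y r).nat = s.nat := rfl
@[simp] theorem setRealArr_real : (s.setRealArr a y r).real = s.real := rfl
@[simp] theorem setRealArr_natArr : (s.setRealArr a y r).natArr = s.natArr := rfl
@[simp] theorem setRealArr_realArr : (s.setRealArr a y r).realArr =
    Function.update s.realArr a (Function.update (s.realArr a) y r) := rfl

end

/-! ### Rules for upper bounds on running times -/

section

variable {op : ℕ → ℝ → ℝ → ℝ} {inp : Input} {body : Program}

theorem RunsTo.of_basic {b : Basic} {s s' : State} (h : b.step op inp s = s') :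
    RunsTo op inp body (.basic b) s s' 1 := ⟨1, le_rfl, h ▸ .basic b s⟩

theorem RunsTo.seq {p q : Program} {s₁ s₂ s₃ : State} {T₁ T₂ : ℕ}
    (h₁ : RunsTo op inp body p s₁ s₂ T₁) (h₂ : RunsTo op inp body q s₂ s₃ T₂) :
    RunsTo op inp body (p ;; q) s₁ s₃ (T₁ + T₂) := by
  obtain ⟨t₁, k₁, e₁⟩ := h₁
  obtain ⟨t₂, k₂, e₂⟩ := h₂
  exact ⟨t₁ + t₂, add_le_add k₁ k₂, .seq e₁ e₂⟩

theorem RunsTo.ite {c : Test} {p q : Program} {s s' : State} {T : ℕ}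
    (h₁ : c.Holds s → RunsTo op inp body p s s' T)
    (h₂ : ¬ c.Holds s → RunsTo op inp body q s s' T) :
    RunsTo op inp body (.ite c p q) s s' (T + 1) := by
  by_cases hc : c.Holds s
  · obtain ⟨t, k, e⟩ := h₁ hc
    exact ⟨t + 1, Nat.succ_le_succ k, .iteTrue hc e⟩
  · obtain ⟨t, k, e⟩ := h₂ hc
    exact ⟨t + 1, Nat.succ_le_succ k, .iteFalse hc e⟩

theorem RunsTo.mono {p : Program} {s s' : State} {T T' : ℕ} (h : RunsTo op inp body p s s' T)
    (hT : T ≤ T') : RunsTo op inp body p s s' T' := by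
  obtain ⟨t, k, e⟩ := h
  exact ⟨t, k.trans hT, e⟩

/-- A loop which is run through `N` times. -/
theorem RunsTo.while_count {c : Test} {p : Program} (Inv : ℕ → State → Prop) {N T : ℕ}
    (hstep : ∀ m < N, ∀ s, Inv m s → c.Holds s ∧ ∃ s', RunsTo op inp body p s s' T ∧
      Inv (m + 1) s')
    (hend : ∀ s, Inv N s → ¬ c.Holds s) {s : State} (hs : Inv 0 s) :
    ∃ s', RunsTo op inp body (.while c p) s s' (N * (T + 1) + 1) ∧ Inv N s' := by
  suffices ∀ m k s, m + k = N → Inv k s →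
      ∃ s', RunsTo op inp body (.while c p) s s' (m * (T + 1) + 1) ∧ Inv N s' from
    this N 0 s rfl hs
  intro m
  induction m with
  | zero =>
    intro k s hk hs
    obtain rfl : k = N := by omega
    exact ⟨s, ⟨1, by omega, .whileFalse (hend s hs)⟩, hs⟩
  | succ m ih =>
    intro k s hk hs
    obtain ⟨hc, s₁, ⟨t₁, k₁, e₁⟩, hs₁⟩ := hstep k (by omega) s hs
    obtain ⟨s₂, ⟨t₂, k₂, e₂⟩, hs₂⟩ := ih (k + 1) s₁ (by omega) hs₁
    refine ⟨s₂, ⟨t₁ + t₂ + 1, ?_, .whileTrue hc e₁ e₂⟩, hs₂⟩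
    rw [add_mul]
    omega

end

/-- The constants in the registers on which all parts of the algorithm rely. -/
structure Ready (mf mg : ℕ) (s : State) : Prop where
  nat6 : s.nat 6 = mf
  nat7 : s.nat 7 = mg
  nat8 : s.nat 8 = 0
  nat9 : s.nat 9 = 1
  real8 : s.real 8 = 0
  real9 : s.real 9 = 1

/-- Branch according to whether the real register `x` is below the real register `y`. -/
def branch (b : Bool) (x y : ℕ) (p q : Program) : Program :=
  if b then .ite (.realLe y x) q p else .ite (.realLe x y) p q

/-- `out := edgeLo b flag x y lo₁ lo₂ (0 < c)`, with the real register `14` for `l`. -/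
def edgeProg (b : Bool) (flag x y lo₁ lo₂ c out : ℕ) : Program :=
  .ite (.realLe 9 lo₂) (.basic (.realCopy 14 lo₁)) (.basic (.realCopy 14 8)) ;;
  .ite (.natLt 8 c) (.basic (.realCopy out 8))
    (.ite (.natLt 8 flag)
      (branch b 14 y
        (.ite (.realLe x 14) (.basic (.realCopy out 14)) (.basic (.realCopy out x)))
        (.basic (.realCopy out 9)))
      (.basic (.realCopy out 9)))

/-- Put into the natural register `15` whether the upper right corner is reachable. -/
def cornerProg (b : Bool) : Program :=
  .ite (.natLt 8 3)
    (.ite (.realLe 9 5)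
      (.ite (.realLe 9 13)
        (.ite (.realLe 9 12)
          (if b then .basic (.natConst 15 0) else
            .ite (.natLt 8 12) (.basic (.natConst 15 1))
              (.ite (.natLt 8 13) (.basic (.natConst 15 1)) (.basic (.natConst 15 0))))
          (.basic (.natConst 15 1)))
        (.basic (.natConst 15 1)))
      (.basic (.natConst 15 0)))
    (.basic (.natConst 15 0))

/-- Update the data after the parameters of the cell `(nat 10, nat 11)` have been determined: the
natural array `k` says whether the grid points above the left edges of the current column are
reachable, the real array `k` contains `1 - lo` for these edges, and the natural register `12` and
the real register `12` concern the lower right corner and the lower edge of the current cell. -/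
def cellUpdate (b : Bool) (k : ℕ) : Program :=
  .basic (.realLoad 13 k 11) ;;
  .basic (.realOp 13 .minus 9 13) ;;
  .basic (.natLoad 13 k 11) ;;
  cornerProg b ;;
  edgeProg b 3 1 5 13 12 12 15 ;;
  edgeProg b 4 2 6 12 13 13 16 ;;
  .basic (.realOp 15 .minus 9 15) ;;
  .basic (.realStore k 11 15) ;;
  .basic (.natStore k 11 15) ;;
  .basic (.realCopy 12 16) ;;
  .basic (.natCopy 12 15) ;;
  .basic (.natPlus 11 11 9)

/-- Process the column `nat 10` of cells. -/
def columnProg (b : Bool) (k : ℕ) : Program :=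
  .basic (.natConst 11 0) ;;
  .basic (.realCopy 12 10) ;;
  .basic (.natConst 12 0) ;;
  .while (.natLt 11 7) (.call 10 11 ;; cellUpdate b k) ;;
  .basic (.realConst 10 1) ;;
  .basic (.natPlus 10 10 9)

/-- Set the constants and determine whether the origin is free. -/
def setupProg (k : ℕ) : Program :=
  .basic (.readSegF 6) ;;
  .basic (.readSegG 7) ;;
  .basic (.natConst 8 0) ;;
  .basic (.natConst 9 1) ;;
  .basic (.realConst 8 0) ;;
  .basic (.realConst 9 1) ;;
  .basic (.natConst 10 0) ;;
  .basic (.realConst 10 1) ;;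
  .call 8 8 ;;
  .ite (.natLt 8 5) (.ite (.realLe 3 8) (.basic (.realCopy 10 8)) (.basic .nop)) (.basic .nop) ;;
  .basic (.realOp 11 .minus 9 10) ;;
  .basic (.realStore k 8 11)

/-- Decide whether the last grid point is reachable by a (strictly) monotone path. -/
def decideProg (b : Bool) (k : ℕ) : Program :=
  setupProg k ;;
  .while (.natLt 10 6) (columnProg b k) ;;
  .ite (.natLt 8 12) (.basic (.natConst k 1)) (.basic (.natConst k 0))

/-! ### Effect and cost of the loop-free parts -/

section

variable {op : ℕ → ℝ → ℝ → ℝ} {inp : Input} {body : Program} {mf mg : ℕ}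

/-- Real registers can only be tested for `≤`, so the strict comparison is the negation of the
reversed test, with the two branches exchanged. -/
theorem RunsTo.branch {b : Bool} {x y : ℕ} {p q : Program} {s s' : State} {T : ℕ}
    (h₁ : OrdRel b (s.real x) (s.real y) → RunsTo op inp body p s s' T)
    (h₂ : ¬ OrdRel b (s.real x) (s.real y) → RunsTo op inp body q s s' T) :
    RunsTo op inp body (branch b x y p q) s s' (T + 1) := by
  cases b
  · exact RunsTo.ite (fun h => h₁ (ordRel_false.2 h)) fun h => h₂ fun h' => h (ordRel_false.1 h')
  · exact RunsTo.ite (fun h => h₂ fun h' => (ordRel_true.1 h').not_ge h)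
      fun h => h₁ (ordRel_true.2 (not_le.1 h))

/-- Real register `14` is overwritten before `x` and `y` are read, whence the two inequalities. The
bound is `2` steps for the threshold and `5` for the deepest nest of tests. -/
theorem edgeProg_runsTo {b : Bool} {flag x y lo₁ lo₂ c out : ℕ} {s : State} (hs : Ready mf mg s)
    (hx : x ≠ 14) (hy : y ≠ 14) :
    RunsTo op inp body (edgeProg b flag x y lo₁ lo₂ c out) s
      ((s.setReal 14 (if 1 ≤ s.real lo₂ then s.real lo₁ else 0)).setReal out
        (edgeLo b (s.nat flag) (s.real x) (s.real y) (s.real lo₁) (s.real lo₂) (0 < s.nat c))) 7 := by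
  refine RunsTo.seq (T₁ := 2) (T₂ := 5)
    (s₂ := s.setReal 14 (if 1 ≤ s.real lo₂ then s.real lo₁ else 0)) ?_ ?_
  · refine RunsTo.ite (fun h => RunsTo.of_basic ?_) (fun h => RunsTo.of_basic ?_) <;>
      simp only [Test.Holds, hs.real9] at h
    · rw [if_pos h]; rfl
    · rw [if_neg h, ← hs.real8]; rfl
  · unfold edgeLo
    generalize (if 1 ≤ s.real lo₂ then s.real lo₁ else 0) = l
    have e8 : (s.setReal 14 l).real 8 = 0 := by simp [hs.real8]
    have e9 : (s.setReal 14 l).real 9 = 1 := by simp [hs.real9]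
    have el : (s.setReal 14 l).real 14 = l := by simp
    have ex : (s.setReal 14 l).real x = s.real x := by simp [hx]
    have ey : (s.setReal 14 l).real y = s.real y := by simp [hy]
    have copy : ∀ {z : ℕ} {v : ℝ} {T : ℕ}, (s.setReal 14 l).real z = v → 1 ≤ T →
        RunsTo op inp body (.basic (.realCopy out z)) (s.setReal 14 l)
          ((s.setReal 14 l).setReal out v) T := fun h hT =>
      (RunsTo.of_basic (by rw [← h]; rfl)).mono hT
    refine RunsTo.ite (fun h => ?_) fun h => ?_ <;> simp only [Test.Holds, setReal_nat, hs.nat8] at h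
    · rw [if_pos h]
      exact copy e8 (by norm_num)
    rw [if_neg h]
    unfold exitLo
    refine RunsTo.ite (fun h₁ => ?_) fun h₁ => ?_ <;>
      simp only [Test.Holds, setReal_nat, hs.nat8] at h₁
    · refine RunsTo.branch (fun h₂ => ?_) fun h₂ => ?_ <;> rw [el, ey] at h₂
      · rw [if_pos ⟨h₁, h₂⟩]
        refine RunsTo.ite (fun h₃ => ?_) fun h₃ => ?_ <;> simp only [Test.Holds, el, ex] at h₃
        · rw [max_eq_right h₃]
          exact copy el le_rfl
        · rw [max_eq_left (not_le.1 h₃).le]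
          exact copy ex le_rfl
      · rw [if_neg fun h => h₂ h.2]
        exact copy e9 (by norm_num)
    · rw [if_neg fun h => h₁ h.1]
      exact copy e9 (by norm_num)

open Classical in
theorem cornerProg_runsTo {b : Bool} {s : State} (hs : Ready mf mg s) :
    RunsTo op inp body (cornerProg b) s
      (s.setNat 15 (if cornerBit b (s.nat 3) (s.real 5) (s.real 13) (s.real 12)
        (0 < s.nat 12) (0 < s.nat 13) then 1 else 0)) 7 := by
  have const : ∀ {c T : ℕ}, 1 ≤ T →
      RunsTo op inp body (.basic (.natConst 15 c)) s (s.setNat 15 c) T := fun hT =>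
    (RunsTo.of_basic rfl).mono hT
  unfold cornerProg cornerBit
  refine RunsTo.ite (fun h₁ => ?_) fun h₁ => ?_ <;> simp only [Test.Holds, hs.nat8] at h₁
  · refine RunsTo.ite (fun h₂ => ?_) fun h₂ => ?_ <;> simp only [Test.Holds, hs.real9] at h₂
    · refine RunsTo.ite (fun h₃ => ?_) fun h₃ => ?_ <;> simp only [Test.Holds, hs.real9] at h₃
      · refine RunsTo.ite (fun h₄ => ?_) fun h₄ => ?_ <;> simp only [Test.Holds, hs.real9] at h₄
        · have h₃' := not_lt.2 h₃
          have h₄' := not_lt.2 h₄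
          cases b
          · refine RunsTo.ite (T := 2) (fun h₅ => ?_) fun h₅ => ?_ <;>
              simp only [Test.Holds, hs.nat8] at h₅
            · rw [if_pos (by simp [h₁, h₂, h₅])]
              exact const (by norm_num)
            · refine RunsTo.ite (fun h₆ => ?_) fun h₆ => ?_ <;>
                simp only [Test.Holds, hs.nat8] at h₆
              · rw [if_pos (by simp [h₁, h₂, h₆])]
                exact const le_rfl
              · rw [if_neg (by simp only [h₃', h₄', h₅, h₆]; simp)]
                exact const le_rfl
          · change RunsTo op inp body (.basic (.natConst 15 0)) s _ _
            rw [if_neg (by simp only [h₃', h₄']; simp)]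
            exact const (by norm_num)
        · rw [if_pos ⟨Or.inr (Or.inl (not_le.1 h₄)), h₁, h₂⟩]
          exact const (by norm_num)
      · rw [if_pos ⟨Or.inl (not_le.1 h₃), h₁, h₂⟩]
        exact const (by norm_num)
    · rw [if_neg fun h => h₂ h.2.2]
      exact const (by norm_num)
  · rw [if_neg fun h => h₁ h.2.1]
    exact const (by norm_num)

theorem Ready.congr {s s' : State} (hs : Ready mf mg s) (h6 : s'.nat 6 = s.nat 6)
    (h7 : s'.nat 7 = s.nat 7) (h8 : s'.nat 8 = s.nat 8) (h9 : s'.nat 9 = s.nat 9)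
    (k8 : s'.real 8 = s.real 8) (k9 : s'.real 9 = s.real 9) : Ready mf mg s' :=
  ⟨h6.trans hs.nat6, h7.trans hs.nat7, h8.trans hs.nat8, h9.trans hs.nat9, k8.trans hs.real8,
    k9.trans hs.real9⟩

/-- The results, arrays and constants of `s'` are those of `s`, apart from the arrays `k`. -/
structure Frame (k : ℕ) (s s' : State) : Prop where
  nat0 : s'.nat 0 = s.nat 0
  nat1 : s'.nat 1 = s.nat 1
  natArr : ∀ a ≠ k, s'.natArr a = s.natArr a
  realArr : ∀ a ≠ k, s'.realArr a = s.realArr a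

theorem Frame.trans {k : ℕ} {s₁ s₂ s₃ : State} (h : Frame k s₁ s₂) (h' : Frame k s₂ s₃) :
    Frame k s₁ s₃ :=
  ⟨h'.nat0.trans h.nat0, h'.nat1.trans h.nat1, fun a ha => (h'.natArr a ha).trans (h.natArr a ha),
    fun a ha => (h'.realArr a ha).trans (h.realArr a ha)⟩

-- The corner bit and the two new edge values all refer to the old data in registers `12` and `13`.
-- The program therefore collects them in natural register `15` and real registers `15`, `16`, and
-- overwrites the old data only at the end.
open Classical in
theorem cellUpdate_runsTo {b : Bool} {k : ℕ} {s : State} (hs : Ready mf mg s) {i j : ℕ}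
    (hi : s.nat 10 = i) (hj : s.nat 11 = j) {loL : ℝ} (hL : 1 - s.realArr k j = loL) :
    ∃ s', RunsTo op inp body (cellUpdate b k) s s' 30 ∧ Ready mf mg s' ∧ Frame k s s' ∧
      s'.nat 10 = i ∧ s'.nat 11 = j + 1 ∧
      (0 < s'.nat 12 ↔ cornerBit b (s.nat 3) (s.real 5) loL (s.real 12) (0 < s.nat 12)
        (0 < s.natArr k j)) ∧
      s'.real 12 = edgeLo b (s.nat 4) (s.real 2) (s.real 6) (s.real 12) loL (0 < s.natArr k j) ∧
      (∀ j', s'.natArr k j' = if j' = j then s'.nat 12 else s.natArr k j') ∧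
      (∀ j', 1 - s'.realArr k j' = if j' = j then
        edgeLo b (s.nat 3) (s.real 1) (s.real 5) loL (s.real 12) (0 < s.nat 12)
        else 1 - s.realArr k j') := by
  set s₁ := ((s.setReal 13 (s.realArr k j)).setReal 13 loL).setNat 13 (s.natArr k j) with hs₁
  have r₁ : Ready mf mg s₁ := hs.congr (by simp [hs₁]) (by simp [hs₁]) (by simp [hs₁])
    (by simp [hs₁]) (by simp [hs₁]) (by simp [hs₁])
  have c₁ := cornerProg_runsTo (op := op) (inp := inp) (body := body) (b := b) r₁
  set bit := (if cornerBit b (s₁.nat 3) (s₁.real 5) (s₁.real 13) (s₁.real 12)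
        (0 < s₁.nat 12) (0 < s₁.nat 13) then 1 else 0) with hbit
  set s₂ := s₁.setNat 15 bit with hs₂
  have r₂ : Ready mf mg s₂ := r₁.congr (by simp [hs₂]) (by simp [hs₂]) (by simp [hs₂])
    (by simp [hs₂]) (by simp [hs₂]) (by simp [hs₂])
  have c₂ := edgeProg_runsTo (op := op) (inp := inp) (body := body) (b := b) (flag := 3) (x := 1)
    (y := 5) (lo₁ := 13) (lo₂ := 12) (c := 12) (out := 15) r₂ (by norm_num) (by norm_num)
  set l₂ := (if 1 ≤ s₂.real 12 then s₂.real 13 else 0)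
  set e₂ := edgeLo b (s₂.nat 3) (s₂.real 1) (s₂.real 5) (s₂.real 13) (s₂.real 12)
    (0 < s₂.nat 12) with he₂
  set s₃ := (s₂.setReal 14 l₂).setReal 15 e₂ with hs₃
  have r₃ : Ready mf mg s₃ := r₂.congr (by simp [hs₃]) (by simp [hs₃]) (by simp [hs₃])
    (by simp [hs₃]) (by simp [hs₃]) (by simp [hs₃])
  have c₃ := edgeProg_runsTo (op := op) (inp := inp) (body := body) (b := b) (flag := 4) (x := 2)
    (y := 6) (lo₁ := 12) (lo₂ := 13) (c := 13) (out := 16) r₃ (by norm_num) (by norm_num)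
  set l₃ := (if 1 ≤ s₃.real 13 then s₃.real 12 else 0)
  set e₃ := edgeLo b (s₃.nat 4) (s₃.real 2) (s₃.real 6) (s₃.real 12) (s₃.real 13)
    (0 < s₃.nat 13) with he₃
  set s₄ := (s₃.setReal 14 l₃).setReal 16 e₃ with hs₄
  set s₅ := (((((s₄.setReal 15 (1 - e₂)).setRealArr k j (1 - e₂)).setNatArr k j bit).setReal 12
    e₃).setNat 12 bit).setNat 11 (j + 1) with hs₅
  have hbit' : bit = if cornerBit b (s.nat 3) (s.real 5) loL (s.real 12) (0 < s.nat 12)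
      (0 < s.natArr k j) then 1 else 0 := by simp [hbit, hs₁]
  have he₂' : e₂ = edgeLo b (s.nat 3) (s.real 1) (s.real 5) loL (s.real 12) (0 < s.nat 12) := by
    simp [he₂, hs₂, hs₁]
  have he₃' : e₃ = edgeLo b (s.nat 4) (s.real 2) (s.real 6) (s.real 12) loL
      (0 < s.natArr k j) := by simp [he₃, hs₃, hs₂, hs₁]
  have n₄ : s₄.nat = s₂.nat := rfl
  have n15 : s₂.nat 15 = bit := by simp [hs₂]
  have n11 : s₂.nat 11 = j := by simp [hs₂, hs₁, hj]
  have n9 : s₂.nat 9 = 1 := r₂.nat9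
  have ra₄ : s₄.realArr = s.realArr := rfl
  have na₄ : s₄.natArr = s.natArr := rfl
  have r9 : s₄.real 9 = 1 := by simp [hs₄, r₃.real9]
  have r15 : s₄.real 15 = e₂ := by simp [hs₄, hs₃]
  have r16 : s₄.real 16 = e₃ := by simp [hs₄]
  clear_value bit e₂ e₃ l₂ l₃
  refine ⟨s₅, ?_, ?_, ?_, ?_, ?_, ?_, ?_, ?_, ?_⟩
  · refine RunsTo.mono (T := 1 + (1 + (1 + (7 + (7 + (7 + (1 + (1 + (1 + (1 + (1 + 1))))))))))) ?_
      (by norm_num)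
    refine .seq (.of_basic (s' := s.setReal 13 (s.realArr k j)) ?_) ?_
    · rw [← hj]; rfl
    refine .seq (.of_basic (s' := (s.setReal 13 (s.realArr k j)).setReal 13 loL) ?_) ?_
    · rw [← hL]
      simp only [Basic.step, RealOp.eval, State.setReal]
      simp [hs.real9]
    refine .seq (.of_basic (s' := s₁) ?_) ?_
    · rw [hs₁, ← hj]; rfl
    refine .seq c₁ (.seq c₂ (.seq c₃ ?_))
    refine .seq (.of_basic (s' := s₄.setReal 15 (1 - e₂)) ?_) ?_
    · simp only [Basic.step, RealOp.eval, r9, r15]; rfl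
    refine .seq (.of_basic (s' := (s₄.setReal 15 (1 - e₂)).setRealArr k j (1 - e₂)) ?_) ?_
    · simp [Basic.step, State.setRealArr, n₄, n11]
    refine .seq (.of_basic (s' := ((s₄.setReal 15 (1 - e₂)).setRealArr k j (1 - e₂)).setNatArr k j
      bit) ?_) ?_
    · simp [Basic.step, State.setNatArr, n₄, n11, n15]
    refine .seq (.of_basic (s' := (((s₄.setReal 15 (1 - e₂)).setRealArr k j (1 - e₂)).setNatArr k j
      bit).setReal 12 e₃) ?_) ?_
    · simp [Basic.step, State.setReal, r16]
    refine .seq (.of_basic (s' := ((((s₄.setReal 15 (1 - e₂)).setRealArr k j (1 - e₂)).setNatArr k j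
      bit).setReal 12 e₃).setNat 12 bit) ?_) ?_
    · simp [Basic.step, State.setNat, n₄, n15]
    refine .of_basic ?_
    simp [Basic.step, hs₅, State.setNat, n₄, n11, n9]
  · exact r₃.congr (by simp [hs₅, hs₄]) (by simp [hs₅, hs₄]) (by simp [hs₅, hs₄])
      (by simp [hs₅, hs₄]) (by simp [hs₅, hs₄]) (by simp [hs₅, hs₄])
  · refine ⟨?_, ?_, ?_, ?_⟩
    · simp [hs₅, n₄, hs₂, hs₁]
    · simp [hs₅, n₄, hs₂, hs₁]
    · intro a ha
      simp [hs₅, na₄, ha]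
    · intro a ha
      simp [hs₅, ra₄, ha]
  · simp [hs₅, n₄, hs₂, hs₁, hi]
  · simp [hs₅]
  · have : s₅.nat 12 = bit := by simp [hs₅]
    rw [this, hbit']
    split_ifs with h <;> simp [h]
  · simpa [hs₅] using he₃'
  · intro j'
    simp [hs₅, na₄, Function.update_apply]
  · intro j'
    rw [← he₂']
    simp only [hs₅, setNat_realArr, setReal_realArr, setNatArr_realArr, setRealArr_realArr, ra₄,
      Function.update_self, Function.update_apply]
    split_ifs <;> ring

end

end RealRAM

/-! ### Correctness and running time through loop invariants -/

namespace RealRAM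

theorem Exec.steps_pos {op : ℕ → ℝ → ℝ → ℝ} {inp : Input} {body p : Program} {s s' : State}
    {t : ℕ} (h : Exec op inp body p s s' t) : 0 < t := by
  induction h <;> omega

section

variable {op : ℕ → ℝ → ℝ → ℝ} {body : Program} {n : ℕ} {χ : Seminorm ℝ (Fin n → ℝ)} {H : ℕ}
  {mf mg : ℕ} {f g : ℝ → Fin n → ℝ} {δ : ℝ}

/-- A return overwrites only natural registers `2` to `5` and real registers `0` to `7`; the working
data of the caller lie above these, and the final answers below, in natural registers `0` and `1`.
-/
theorem ComputesCellParameters.runsTo_call (h : ComputesCellParameters op body χ H)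
    (hf : IsPolygonalCurve mf f) (hg : IsPolygonalCurve mg g) (hδ : 0 ≤ δ) {i j : ℕ} (hi : i < mf)
    (hj : j < mg) {s : State} {x y : ℕ} (hx : s.nat x = i) (hy : s.nat y = j) :
    ∃ s', RunsTo op (Input.ofCurves mf mg f g δ) body (.call x y) s s' (H + 1) ∧
      (∀ z, ¬ (2 ≤ z ∧ z ≤ 5) → s'.nat z = s.nat z) ∧ (∀ z, ¬ z ≤ 7 → s'.real z = s.real z) ∧
      s'.natArr = s.natArr ∧ s'.realArr = s.realArr ∧
      ∀ q : Fin 4, IsExtent (freeEdge χ mf mg f g δ i j q)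
        (s'.nat (2 + (q : ℕ))) (s'.real (q : ℕ)) (s'.real (4 + (q : ℕ))) := by
  obtain ⟨t, T, hexec, hT, hq⟩ := h mf mg f g δ hf hg hδ i hi j hj
  refine ⟨s.return t, ⟨T + 1, by omega, .call (by rwa [hx, hy])⟩, fun z hz => if_neg hz,
    fun z hz => if_neg hz, rfl, rfl, fun q => ?_⟩
  have h1 : (s.return t).nat (2 + (q : ℕ)) = t.nat (2 + (q : ℕ)) :=
    if_pos ⟨by omega, by omega⟩
  have h2 : (s.return t).real (q : ℕ) = t.real (q : ℕ) := if_pos (by omega)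
  have h3 : (s.return t).real (4 + (q : ℕ)) = t.real (4 + (q : ℕ)) := if_pos (by omega)
  rw [h1, h2, h3]
  exact hq q

/-- Both curves have a segment, so cell `(0, 0)` exists and the procedure takes at least one step on
it. This allows constant overhead per cell to be charged to `H`. -/
theorem ComputesCellParameters.bound_pos (h : ComputesCellParameters op body χ H)
    (hf : IsPolygonalCurve mf f) (hg : IsPolygonalCurve mg g) (hδ : 0 ≤ δ) : 0 < H := by
  obtain ⟨t, T, hexec, hT, -⟩ := h mf mg f g δ hf hg hδ 0 hf.pos 0 hg.pos
  exact hexec.steps_pos.trans_le hT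

/-- What is known about the memory before cell `(i, j)` is processed. -/
structure CellInv (b : Bool) (k : ℕ) (F : Set (ℝ × ℝ)) (mf mg : ℕ) (s₀ : State) (i j : ℕ)
    (s : State) : Prop where
  ready : Ready mf mg s
  frame : Frame k s₀ s
  nat10 : s.nat 10 = i
  nat11 : s.nat 11 = j
  hor : HorReach b F i j (s.real 12)
  corner : CornerReach b F (i + 1) j (0 < s.nat 12)
  done : ∀ j' < j, VertReach b F (i + 1) j' (1 - s.realArr k j') ∧
    CornerReach b F (i + 1) (j' + 1) (0 < s.natArr k j')
  todo : ∀ j', j ≤ j' → j' < mg → VertReach b F i j' (1 - s.realArr k j') ∧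
    CornerReach b F i (j' + 1) (0 < s.natArr k j')

/-- The state of the computation before column `i` is processed. -/
structure ColumnInv (b : Bool) (k : ℕ) (F : Set (ℝ × ℝ)) (mf mg : ℕ) (s₀ : State) (i : ℕ)
    (s : State) : Prop where
  ready : Ready mf mg s
  frame : Frame k s₀ s
  nat10 : s.nat 10 = i
  hor : HorReach b F i 0 (s.real 10)
  corner : 0 < i → CornerReach b F i mg (0 < s.nat 12)
  column : ∀ j < mg, VertReach b F i j (1 - s.realArr k j) ∧
    CornerReach b F i (j + 1) (0 < s.natArr k j)

theorem cell_runsTo (h : ComputesCellParameters op body χ H)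
    (hf : IsPolygonalCurve mf f) (hg : IsPolygonalCurve mg g) (hδ : 0 ≤ δ) {b : Bool} {k i j : ℕ}
    (hi : i < mf) (hj : j < mg) {s₀ s : State}
    (hs : CellInv b k (freeSpace χ mf mg f g δ) mf mg s₀ i j s) :
    ∃ s', RunsTo op (Input.ofCurves mf mg f g δ) body (.call 10 11 ;; cellUpdate b k) s s'
        (H + 31) ∧
      CellInv b k (freeSpace χ mf mg f g δ) mf mg s₀ i (j + 1) s' := by
  obtain ⟨s₁, hcall, hnat, hreal, hna, hra, hext⟩ := h.runsTo_call hf hg hδ hi hj hs.nat10 hs.nat11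
  have r₁ : Ready mf mg s₁ := hs.ready.congr (hnat _ (by norm_num)) (hnat _ (by norm_num))
    (hnat _ (by norm_num)) (hnat _ (by norm_num)) (hreal _ (by norm_num)) (hreal _ (by norm_num))
  obtain ⟨hv, hc⟩ := hs.todo j le_rfl hj
  obtain ⟨s₂, hup, r₂, f₂, h10, h11, hbit, htop, hna', hra'⟩ :=
    cellUpdate_runsTo (op := op) (inp := Input.ofCurves mf mg f g δ) (body := body) (b := b)
      (k := k) r₁ (i := i) (j := j) ((hnat _ (by norm_num)).trans hs.nat10)
      ((hnat _ (by norm_num)).trans hs.nat11) rfl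
  have h12 : s₁.nat 12 = s.nat 12 := hnat _ (by norm_num)
  have k12 : s₁.real 12 = s.real 12 := hreal _ (by norm_num)
  simp only [hra, hna, h12, k12] at hbit htop hna' hra'
  have hconv := convex_freeSpace_inter_gridCell (χ := χ) (δ := δ) hf hg hi hj
  have eR : IsExtent (rightEdge (freeSpace χ mf mg f g δ) i j) (s₁.nat 3) (s₁.real 1)
    (s₁.real 5) := hext 1
  have eT : IsExtent {s | s ∈ Icc (0 : ℝ) 1 ∧ ((i : ℝ) + s, (j : ℝ) + 1) ∈
    freeSpace χ mf mg f g δ} (s₁.nat 4) (s₁.real 2) (s₁.real 6) := hext 2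
  have nc : CornerReach b (freeSpace χ mf mg f g δ) (i + 1) (j + 1) (0 < s₂.nat 12) := by
    have := CornerReach.next hconv eR hv hs.hor hs.corner hc
    rwa [← hbit] at this
  have nv := VertReach.right hconv eR hv hs.hor hs.corner
  have nh := HorReach.top hconv eT hv hs.hor hc
  refine ⟨s₂, (RunsTo.seq hcall hup).mono (by omega), r₂, ?_, h10, h11, ?_, nc, ?_, ?_⟩
  · refine hs.frame.trans (Frame.trans ⟨hnat _ (by norm_num), hnat _ (by norm_num), ?_, ?_⟩ f₂)
    · intro a _; rw [hna]
    · intro a _; rw [hra]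
  · rwa [htop]
  · intro j' hj'
    rw [hra', hna']
    rcases eq_or_ne j' j with rfl | hne
    · rw [if_pos rfl, if_pos rfl]
      exact ⟨nv, nc⟩
    · rw [if_neg hne, if_neg hne]
      exact hs.done j' (by omega)
  · intro j' hj' hj'm
    rw [hra', hna', if_neg (by omega), if_neg (by omega)]
    exact hs.todo j' (by omega) hj'm

theorem columnProg_runsTo (h : ComputesCellParameters op body χ H)
    (hf : IsPolygonalCurve mf f) (hg : IsPolygonalCurve mg g) (hδ : 0 ≤ δ) {b : Bool} {k i : ℕ}
    (hi : i < mf) {s₀ s : State}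
    (hs : ColumnInv b k (freeSpace χ mf mg f g δ) mf mg s₀ i s) :
    ∃ s', RunsTo op (Input.ofCurves mf mg f g δ) body (columnProg b k) s s'
        (mg * (H + 32) + 6) ∧
      ColumnInv b k (freeSpace χ mf mg f g δ) mf mg s₀ (i + 1) s' := by
  set s₁ := ((s.setNat 11 0).setReal 12 (s.real 10)).setNat 12 0 with hs₁
  have inv₁ : CellInv b k (freeSpace χ mf mg f g δ) mf mg s₀ i 0 s₁ := by
    refine ⟨hs.ready.congr (by simp [hs₁]) (by simp [hs₁]) (by simp [hs₁]) (by simp [hs₁])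
      (by simp [hs₁]) (by simp [hs₁]), hs.frame.trans ⟨by simp [hs₁], by simp [hs₁], by simp [hs₁],
      by simp [hs₁]⟩, by simp [hs₁, hs.nat10], by simp [hs₁], by simpa [hs₁] using hs.hor, ?_, ?_,
      fun j' _ hj' => by simpa [hs₁] using hs.column j' hj'⟩
    · simpa [hs₁] using CornerReach.lower_boundary
    · exact fun j' hj' => absurd hj' (Nat.not_lt_zero j')
  obtain ⟨s₂, hrun, inv₂⟩ := RunsTo.while_count (op := op) (inp := Input.ofCurves mf mg f g δ)
    (body := body) (c := .natLt 11 7) (N := mg) (T := H + 31)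
    (CellInv b k (freeSpace χ mf mg f g δ) mf mg s₀ i) (fun j hj s hs =>
      ⟨by simpa [Test.Holds, hs.nat11, hs.ready.nat7] using hj, cell_runsTo h hf hg hδ hi hj hs⟩)
    (fun s hs => by simp [Test.Holds, hs.nat11, hs.ready.nat7]) inv₁
  -- Real register `10` holds `lo` for the lower boundary edge of the next column; the value `1` is
  -- right because only column `0` contains the origin.
  set s₃ := (s₂.setReal 10 1).setNat 10 (i + 1) with hs₃
  refine ⟨s₃, ?_, ?_⟩
  · refine RunsTo.mono (T := 1 + (1 + (1 + ((mg * (H + 31 + 1) + 1) + (1 + 1))))) ?_ (by ring_nf; rfl)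
    refine .seq (.of_basic (s' := s.setNat 11 0) rfl) ?_
    refine .seq (.of_basic (s' := (s.setNat 11 0).setReal 12 (s.real 10)) rfl) ?_
    refine .seq (.of_basic (s' := s₁) rfl) (.seq hrun ?_)
    refine .seq (.of_basic (s' := s₂.setReal 10 1) ?_) (.of_basic ?_)
    · simp [Basic.step, State.setReal]
    · simp [Basic.step, hs₃, State.setNat, inv₂.nat10, inv₂.ready.nat9]
  · refine ⟨inv₂.ready.congr (by simp [hs₃]) (by simp [hs₃]) (by simp [hs₃]) (by simp [hs₃])
      (by simp [hs₃]) (by simp [hs₃]), inv₂.frame.trans ⟨by simp [hs₃], by simp [hs₃],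
      by simp [hs₃], by simp [hs₃]⟩, by simp [hs₃], ?_, fun _ => by simpa [hs₃] using inv₂.corner,
      fun j hj => by simpa [hs₃] using inv₂.done j hj⟩
    simpa [hs₃] using HorReach.boundary i.succ_pos

theorem setupProg_runsTo (h : ComputesCellParameters op body χ H)
    (hf : IsPolygonalCurve mf f) (hg : IsPolygonalCurve mg g) (hδ : 0 ≤ δ) (b : Bool) {k : ℕ}
    {s : State} (hn : ∀ j, s.natArr k j = 0) (hr : ∀ j, s.realArr k j = 0) :
    ∃ s', RunsTo op (Input.ofCurves mf mg f g δ) body (setupProg k) s s' (H + 14) ∧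
      ColumnInv b k (freeSpace χ mf mg f g δ) mf mg s 0 s' := by
  set s₁ := (((((((s.setNat 6 mf).setNat 7 mg).setNat 8 0).setNat 9 1).setReal 8 0).setReal 9
    1).setNat 10 0).setReal 10 1 with hs₁
  have r₁ : Ready mf mg s₁ := ⟨by simp [hs₁], by simp [hs₁], by simp [hs₁], by simp [hs₁],
    by simp [hs₁], by simp [hs₁]⟩
  obtain ⟨s₂, hcall, hnat, hreal, hna, hra, hext⟩ := h.runsTo_call hf hg hδ hf.pos hg.pos
    r₁.nat8 r₁.nat8
  have r₂ : Ready mf mg s₂ := r₁.congr (hnat _ (by norm_num)) (hnat _ (by norm_num))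
    (hnat _ (by norm_num)) (hnat _ (by norm_num)) (hreal _ (by norm_num)) (hreal _ (by norm_num))
  -- The norm is accessible through the procedure only: the origin is free exactly when the free
  -- part of the left edge of cell `(0, 0)` is nonempty and starts at `0`.
  have e₃ : IsExtent {s | s ∈ Icc (0 : ℝ) 1 ∧ (((0 : ℕ) : ℝ), ((0 : ℕ) : ℝ) + s) ∈
    freeSpace χ mf mg f g δ} (s₂.nat 5) (s₂.real 3) (s₂.real 7) := hext 3
  have h10 : s₂.real 10 = 1 := (hreal _ (by norm_num)).trans (by simp [hs₁])
  obtain ⟨lo, hlo, hbr⟩ : ∃ lo : ℝ, (lo = 0 ∧ (0, 0) ∈ freeSpace χ mf mg f g δ ∨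
      lo = 1 ∧ (0, 0) ∉ freeSpace χ mf mg f g δ) ∧
      RunsTo op (Input.ofCurves mf mg f g δ) body (.ite (.natLt 8 5) (.ite (.realLe 3 8)
        (.basic (.realCopy 10 8)) (.basic .nop)) (.basic .nop)) s₂ (s₂.setReal 10 lo) 3 := by
    have hnop : ∀ {T : ℕ}, 1 ≤ T →
        RunsTo op (Input.ofCurves mf mg f g δ) body (.basic .nop) s₂ (s₂.setReal 10 1) T :=
      fun hT => (RunsTo.of_basic (by simp [Basic.step, State.setReal, ← h10])).mono hT
    by_cases ho : ((0 : ℝ), (0 : ℝ)) ∈ freeSpace χ mf mg f g δ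
    · refine ⟨0, Or.inl ⟨rfl, ho⟩, ?_⟩
      obtain ⟨hpos, hle, -⟩ := e₃.pos_of_mem (s := 0) ⟨⟨le_rfl, zero_le_one⟩, by simpa using ho⟩
      refine RunsTo.ite (fun _ => RunsTo.ite (fun _ => RunsTo.of_basic ?_) fun hc => ?_) fun hc => ?_
      · rw [← r₂.real8]; rfl
      · exact absurd (by simpa [Test.Holds, r₂.real8] using hle) hc
      · exact absurd (by simpa [Test.Holds, r₂.nat8] using hpos) hc
    · refine ⟨1, Or.inr ⟨rfl, ho⟩, ?_⟩
      refine RunsTo.ite (fun hc => RunsTo.ite (fun hc' => ?_) fun _ => hnop le_rfl)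
        fun _ => hnop (by norm_num)
      simp only [Test.Holds, r₂.nat8, r₂.real8] at hc hc'
      have hm := (e₃.mem hc).1
      have h0 : s₂.real 3 = 0 := le_antisymm hc' hm.1.1
      exact absurd (by simpa [h0] using hm.2) ho
  set s₄ := ((s₂.setReal 10 lo).setReal 11 (1 - lo)).setRealArr k 0 (1 - lo) with hs₄
  have hna₁ : s₂.natArr = s.natArr := hna
  have hra₁ : s₂.realArr = s.realArr := hra
  have r9 := r₂.real9
  have n8 := r₂.nat8
  refine ⟨s₄, ?_, ?_⟩
  · refine RunsTo.mono (T := 1 + (1 + (1 + (1 + (1 + (1 + (1 + (1 + ((H + 1) + (3 + (1 + 1)))))))))))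
      ?_ (by omega)
    refine .seq (.of_basic (s' := s.setNat 6 mf) rfl) ?_
    refine .seq (.of_basic (s' := (s.setNat 6 mf).setNat 7 mg) rfl) ?_
    refine .seq (.of_basic (s' := ((s.setNat 6 mf).setNat 7 mg).setNat 8 0) rfl) ?_
    refine .seq (.of_basic (s' := (((s.setNat 6 mf).setNat 7 mg).setNat 8 0).setNat 9 1) rfl) ?_
    refine .seq (.of_basic (s' := ((((s.setNat 6 mf).setNat 7 mg).setNat 8 0).setNat 9 1).setReal
      8 0) (by simp [Basic.step, State.setReal])) ?_
    refine .seq (.of_basic (s' := (((((s.setNat 6 mf).setNat 7 mg).setNat 8 0).setNat 9 1).setReal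
      8 0).setReal 9 1) (by simp [Basic.step, State.setReal])) ?_
    refine .seq (.of_basic (s' := ((((((s.setNat 6 mf).setNat 7 mg).setNat 8 0).setNat 9 1).setReal
      8 0).setReal 9 1).setNat 10 0) rfl) ?_
    refine .seq (.of_basic (s' := s₁) (by simp [Basic.step, State.setReal, hs₁])) (.seq hcall
      (.seq hbr ?_))
    refine .seq (.of_basic (s' := (s₂.setReal 10 lo).setReal 11 (1 - lo)) ?_) (.of_basic ?_)
    · simp [Basic.step, RealOp.eval, State.setReal, r9]
    · simp [Basic.step, hs₄, State.setRealArr, n8]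
  · have frame : Frame k s s₄ := by
      refine ⟨?_, ?_, ?_, ?_⟩
      · simpa [hs₄, hs₁] using hnat 0 (by norm_num)
      · simpa [hs₄, hs₁] using hnat 1 (by norm_num)
      · intro a _
        simp [hs₄, hna₁]
      · intro a ha
        simp [hs₄, hra₁, ha]
    refine ⟨r₂.congr (by simp [hs₄]) (by simp [hs₄]) (by simp [hs₄]) (by simp [hs₄])
      (by simp [hs₄]) (by simp [hs₄]), frame, ?_, ?_, fun h0 => absurd h0 (lt_irrefl 0), ?_⟩
    · simpa [hs₄, hs₁] using hnat 10 (by norm_num)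
    · simpa [hs₄] using HorReach.origin (b := b) hlo
    · intro j _
      constructor
      · rcases j.eq_zero_or_pos with rfl | hj
        · simpa [hs₄] using VertReach.origin (b := b) hlo
        -- This is why arrays store `1 - lo`: a zero entry already means that nothing on the edge is
        -- reachable, so no initialization is needed.
        · simpa [hs₄, hra₁, Function.update_apply, hj.ne', hr] using VertReach.boundary hj
      · simpa [hs₄, hna₁, hn] using CornerReach.left_boundary

/-- The algorithm decides the existence of (strictly) monotone paths through the free space. -/
theorem decideProg_runsTo (h : ComputesCellParameters op body χ H)
    (hf : IsPolygonalCurve mf f) (hg : IsPolygonalCurve mg g) (hδ : 0 ≤ δ) (b : Bool) {k : ℕ}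
    {s : State} (hn : ∀ j, s.natArr k j = 0) (hr : ∀ j, s.realArr k j = 0) :
    ∃ s', RunsTo op (Input.ofCurves mf mg f g δ) body (decideProg b k) s s' (58 * (mf * mg * H)) ∧
      (s'.nat k = 1 ↔
        Conn b (freeSpace χ mf mg f g δ) (0, 0) ((mf : ℝ), (mg : ℝ))) ∧
      (∀ x ≤ 1, x ≠ k → s'.nat x = s.nat x) ∧
      (∀ a ≠ k, s'.natArr a = s.natArr a ∧ s'.realArr a = s.realArr a) := by
  obtain ⟨s₁, run₁, inv₁⟩ := setupProg_runsTo h hf hg hδ b hn hr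
  obtain ⟨s₂, run₂, inv₂⟩ := RunsTo.while_count (op := op) (inp := Input.ofCurves mf mg f g δ)
    (body := body) (c := .natLt 10 6) (N := mf) (T := mg * (H + 32) + 6)
    (ColumnInv b k (freeSpace χ mf mg f g δ) mf mg s) (fun i hi s hs =>
      ⟨by simpa [Test.Holds, hs.nat10, hs.ready.nat6] using hi, columnProg_runsTo h hf hg hδ hi hs⟩)
    (fun s hs => by simp [Test.Holds, hs.nat10, hs.ready.nat6]) inv₁
  have hc := inv₂.corner hf.pos
  have n8 := inv₂.ready.nat8
  set v := if 0 < s₂.nat 12 then 1 else 0 with hv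
  refine ⟨s₂.setNat k v, ?_, ?_, ?_, ?_⟩
  · have run₃ : RunsTo op (Input.ofCurves mf mg f g δ) body
        (.ite (.natLt 8 12) (.basic (.natConst k 1)) (.basic (.natConst k 0))) s₂
        (s₂.setNat k v) 2 := by
      refine RunsTo.ite (fun hc => RunsTo.of_basic ?_) (fun hc => RunsTo.of_basic ?_) <;>
        simp only [Test.Holds, n8] at hc
      · rw [hv, if_pos hc]; rfl
      · rw [hv, if_neg hc]; rfl
    refine (RunsTo.seq run₁ (RunsTo.seq run₂ run₃)).mono ?_
    have hH := h.bound_pos hf hg hδ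
    have h1 : 1 ≤ mf * mg := Nat.mul_pos hf.pos hg.pos
    have h2 : mf ≤ mf * mg := Nat.le_mul_of_pos_right _ hg.pos
    have h3 : mf * mg ≤ mf * mg * H := Nat.le_mul_of_pos_right _ hH
    have h4 : H ≤ mf * mg * H := Nat.le_mul_of_pos_left _ h1
    -- Each term is at most a multiple of `mf * mg * H`: setup gives `1 + 14`, the loop `1 + 32 + 7
    -- + 1` and the final test `2`, in total `58`.
    have e : mf * (mg * (H + 32) + 6 + 1) = mf * mg * H + 32 * (mf * mg) + 7 * mf := by ring
    rw [e]
    omega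
  · have : (s₂.setNat k v).nat k = v := by simp
    rw [this, hv]
    refine ⟨fun h1 => hc.sound ?_, fun h1 => if_pos (hc.complete hf.pos hg.pos h1)⟩
    by_contra h0
    rw [if_neg h0] at h1
    exact absurd h1 (by norm_num)
  · intro x hx hxk
    rw [setNat_nat, if_neg hxk]
    interval_cases x
    · exact inv₂.frame.nat0
    · exact inv₂.frame.nat1
  · exact fun a ha => ⟨inv₂.frame.natArr a ha, inv₂.frame.realArr a ha⟩

end

end RealRAM

theorem mainTheorem4 :
    ∃ (D : RealRAM.Program) (C : ℕ),
      ∀ (op : ℕ → ℝ → ℝ → ℝ) (body : RealRAM.Program)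
        (n : ℕ) (χ : Seminorm ℝ (Fin n → ℝ)) (H : ℕ),
        IsNorm χ → RealRAM.ComputesCellParameters op body χ H →
        ∀ (mf mg : ℕ) (f g : ℝ → Fin n → ℝ) (δ : ℝ),
          IsPolygonalCurve mf f → IsPolygonalCurve mg g → 0 ≤ δ →
          ∃ (s : RealRAM.State) (t : ℕ),
            RealRAM.Exec op (RealRAM.Input.ofCurves mf mg f g δ) body D
              RealRAM.State.empty s t ∧
            t ≤ C * (mf * mg * H) ∧
            (s.nat 0 = 1 ↔ frechetDist χ mf mg f g ≤ δ) ∧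
            (s.nat 1 = 1 ↔ ∃ (αf αg : ℝ → ℝ) (r : ℝ), IsReparam mf αf ∧ IsReparam mg αg ∧
              IsMaxDeviation χ f g αf αg r ∧ r ≤ δ) := by
  -- The weak and the strict run use different arrays, so the second also starts from zeros, and
  -- different answer registers; `116 = 2 * 58`.
  refine ⟨.seq (RealRAM.decideProg false 0) (RealRAM.decideProg true 1), 116, ?_⟩
  intro op body n χ H _ h mf mg f g δ hf hg hδ
  obtain ⟨s₁, run₁, dec₁, -, arr₁⟩ := RealRAM.decideProg_runsTo h hf hg hδ false (k := 0)
    (s := RealRAM.State.empty) (fun _ => rfl) (fun _ => rfl)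
  obtain ⟨s₂, run₂, dec₂, nat₂, -⟩ := RealRAM.decideProg_runsTo h hf hg hδ true (k := 1)
    (s := s₁) (fun j => by rw [(arr₁ 1 one_ne_zero).1]; rfl)
    (fun j => by rw [(arr₁ 1 one_ne_zero).2]; rfl)
  obtain ⟨t, ht, hexec⟩ := run₁.seq run₂
  refine ⟨s₂, t, hexec, by omega, ?_, ?_⟩
  · rw [nat₂ 0 zero_le_one zero_ne_one, dec₁, frechetDist_le_iff_conn hf hg]
  · rw [dec₂, exists_reparam_iff_conn hf hg]
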